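/- Let $p\in(1,\infty)$, and let $G\in C^\infty(\mathbb{R})$ be odd with derivative $\dot G>0$ on $\mathbb{R}$ and $s\mapsto s\,\dot G(s)$ in $L^1(\mathbb{R})$. Let $\psi\in C([0,1])$ be a symmetric cone obstacle, i.e. $\psi|_{[0,1/2]}$ and $\psi|_{[1/2,1]}$ are affine, $\psi(x)=\psi(1-x)$ for all $x\in[0,1]$, $\psi(0)=\psi(1)<0$, and $\psi(x_0)>0$ for some $x_0\in(0,1)$. Put $$M(\psi)=\{v\in W^{2,p}(0,1)\cap W^{1,p}_0(0,1) : v\ge\psi \text{ in }[0,1]\},\qquad \mathcal{E}(v)=\int_0^1 |G(v'(x))'|^p\,dx,$$ where elements of $W^{2,p}(0,1)$ are identified with their continuous representatives on $[0,1]$. A minimizer is a function $u\in M(\psi)$ with $\mathcal{E}(u)\le\mathcal{E}(v)$ for all $v\in M(\psi)$. For $A>0$ let $$H(A)=\frac{\int_0^A s\,\dot G(s)\,(A-s)^{-1/p}\,ds}{\int_0^A \dot G(s)\,(A-s)^{-1/p}\,ds}.$$ Then every minimizer $u\in M(\psi)$ satisfies $$\|u\|_{L^\infty(0,1)}\le \frac12\,\sup_{A>0}H(A),$$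 where the supremum is taken in $[0,\infty]$. In particular, if $\|\psi^+\|_{L^\infty(0,1)}>\frac12\sup_{A>0}H(A)$, where $\psi^+=\max(\psi,0)$, then there is no minimizer $u\in M(\psi)$. -/

import Mathlib

open MeasureTheory Set Filter Topology
open scoped ENNReal ContDiff

namespace PElastica

noncomputable section

/-- Lebesgue measure on the open unit interval `(0,1)`. -/
abbrev unitVol : Measure ℝ := volume.restrict (Ioo (0 : ℝ) 1)

/-- Test functions `φ ∈ C_c^∞(0,1)`. -/
structure IsTestFun (φ : ℝ → ℝ) : Prop where
  smooth : ContDiff ℝ ∞ φ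
  compact : HasCompactSupport φ
  supp : tsupport φ ⊆ Ioo (0 : ℝ) 1

/-- `g` is a weak derivative of `f` on `(0,1)`; both are in `L^1_loc(0,1)`. -/
structure IsWeakDeriv (f g : ℝ → ℝ) : Prop where
  locInt : LocallyIntegrableOn f (Ioo (0 : ℝ) 1)
  locInt' : LocallyIntegrableOn g (Ioo (0 : ℝ) 1)
  integral_eq : ∀ φ : ℝ → ℝ, IsTestFun φ →
    ∫ x in Ioo (0 : ℝ) 1, f x * deriv φ x = -∫ x in Ioo (0 : ℝ) 1, g x * φ x

open Classical in
/-- The weak derivative on `(0,1)` (unique up to null sets), and `0` if there is none. -/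
def weakDeriv (f : ℝ → ℝ) : ℝ → ℝ :=
  if h : ∃ g, IsWeakDeriv f g then h.choose else 0

/-- `f ∈ W^{1,p}(0,1)`. -/
def MemW1 (p : ℝ) (f : ℝ → ℝ) : Prop :=
  MemLp f (ENNReal.ofReal p) unitVol ∧
    ∃ g, IsWeakDeriv f g ∧ MemLp g (ENNReal.ofReal p) unitVol

/-- `f ∈ W^{2,p}(0,1)`. -/
def MemW2 (p : ℝ) (f : ℝ → ℝ) : Prop :=
  MemW1 p f ∧ MemW1 p (weakDeriv f)

/-- `f ∈ W_0^{1,p}(0,1)`, the closure of `C_c^∞(0,1)` in `W^{1,p}(0,1)`. -/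
def MemW10 (p : ℝ) (f : ℝ → ℝ) : Prop :=
  MemW1 p f ∧ ∃ φ : ℕ → ℝ → ℝ, (∀ n, IsTestFun (φ n)) ∧
    Tendsto (fun n => eLpNorm (fun x => f x - φ n x) (ENNReal.ofReal p) unitVol) atTop (𝓝 0) ∧
    Tendsto (fun n => eLpNorm (fun x => weakDeriv f x - deriv (φ n) x)
      (ENNReal.ofReal p) unitVol) atTop (𝓝 0)

/-- Standing assumptions on the obstacle: `ψ ∈ C([0,1])`, negative at the end points and positive
somewhere in between. Only the values of `ψ` on `[0,1]` matter. -/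
structure IsObstacle (ψ : ℝ → ℝ) : Prop where
  cont : ContinuousOn ψ (Icc 0 1)
  neg_left : ψ 0 < 0
  neg_right : ψ 1 < 0
  pos : ∃ x ∈ Ioo (0 : ℝ) 1, 0 < ψ x

/-- A symmetric cone obstacle: an obstacle that is affine on `[0,1/2]` and on `[1/2,1]` and
symmetric about `1/2`. -/
structure IsSymmCone (ψ : ℝ → ℝ) : Prop extends IsObstacle ψ where
  affine_left : ∃ a b : ℝ, ∀ x ∈ Icc (0 : ℝ) (1 / 2), ψ x = a * x + b
  affine_right : ∃ a b : ℝ, ∀ x ∈ Icc (1 / 2 : ℝ) 1, ψ x = a * x + b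
  symm : ∀ x ∈ Icc (0 : ℝ) 1, ψ x = ψ (1 - x)

/-- Standing assumptions on `G`: smooth, odd, `G' > 0` and `s ↦ s G'(s)` in `L^1(ℝ)`. -/
structure IsAdmissibleG (G : ℝ → ℝ) : Prop where
  smooth : ContDiff ℝ ∞ G
  odd : ∀ s, G (-s) = -G s
  deriv_pos : ∀ s, 0 < deriv G s
  integrable : Integrable (fun s => s * deriv G s)

/-- The admissible set `M(ψ) = {v ∈ W^{2,p}(0,1) ∩ W_0^{1,p}(0,1) : v ≥ ψ in [0,1]}`. A class in
`W^{2,p}(0,1)` is represented by its continuous representative on `[0,1]`; the values outside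
`[0,1]` are irrelevant. -/
def admissible (p : ℝ) (ψ : ℝ → ℝ) : Set (ℝ → ℝ) :=
  {v | ContinuousOn v (Icc 0 1) ∧ MemW2 p v ∧ MemW10 p v ∧ ∀ x ∈ Icc (0 : ℝ) 1, ψ x ≤ v x}

/-- The generalized `p`-elastica functional `E(u) = ∫_0^1 |G(u')'|^p dx`. -/
def energy (p : ℝ) (G u : ℝ → ℝ) : ℝ :=
  ∫ x in Ioo (0 : ℝ) 1, |weakDeriv (fun y => G (weakDeriv u y)) x| ^ p

/-- `u ∈ M(ψ)` minimizes the energy in `M(ψ)`. -/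
def IsMinimizer (p : ℝ) (G ψ u : ℝ → ℝ) : Prop :=
  u ∈ admissible p ψ ∧ ∀ v ∈ admissible p ψ, energy p G u ≤ energy p G v

/-- `H(A) = (∫_0^A s G'(s) (A-s)^{-1/p} ds) / (∫_0^A G'(s) (A-s)^{-1/p} ds)`; for `p > 1` and
`A > 0` both integrals converge and the denominator is positive. -/
def ratioH (p : ℝ) (G : ℝ → ℝ) (A : ℝ) : ℝ :=
  (∫ s in (0 : ℝ)..A, s * deriv G s / (A - s) ^ (1 / p)) /
    (∫ s in (0 : ℝ)..A, deriv G s / (A - s) ^ (1 / p))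

/-- `½ sup_{A>0} H(A)`, a number in `[0,∞]` (`H` is nonnegative, but it may be unbounded). -/
def supBound (p : ℝ) (G : ℝ → ℝ) : ℝ≥0∞ :=
  (1 / 2) * ⨆ A : Ioi (0 : ℝ), ENNReal.ofReal (ratioH p G A)

/-- `‖f‖_{L^∞(0,1)}`. -/
def supNorm (f : ℝ → ℝ) : ℝ≥0∞ := eLpNorm f ∞ unitVol

end

end PElastica

/-! A minimizer `u` is concave. Perturb it along `φ` with `φ' = η / G'(u')`: the linearisation of
`G(u')'` is then just `η'`, so the first variation reads `∫ m η'`, up to the factor `p`, with `m =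
|f|^(p-2) f` and `f = G'(u') u''` (`dualField`). Taking `η'` negative exactly where `u'' > 0` gives
an admissible `φ ≥ 0`, and minimality then forces `u'' ≤ 0` a.e. (`IsProfileMinimizer.antitoneOn`).

A concave function vanishing at the end points can touch the cone at most at its tip: an earlier
contact would be tangential, and the tangent line would lie above `0` at the left end, where the
cone is negative. After a reflection a maximum point `X` of `u` lies in `(0, 1/2]`, so variations of
both signs are allowed on `(0, X)` and the Euler-Lagrange equation `m = c K` holds there, with `K' =
1 / G'(u')` and `K(0) = 0` (`IsProfileMinimizer.euler_lagrange`). The integration constant is absent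
because `u'(0)` is free.

This equation integrates explicitly: `u' = A - L`, where `A = u'(0)` and `L` is a multiple of
`K^(p/(p-1))`. Since `u'(X) = 0`, the substitution `s = u'(x)` maps `(0, X)` onto `(0, A)` and turns
`G'(s) (A - s)^(-1/p) ds` into a constant multiple of `dx`. The two integrals in `H(A)` become the
same multiple of `u(X)` and of `X`, so `u(X) = X H(A) ≤ H(A) / 2` (`height_eq_mul_ratioH`). -/

namespace PElastica

/-! ### Calculus of absolutely continuous functions -/

/-- `f` is a primitive of the locally integrable function `g`. -/
def IsPrim (f g : ℝ → ℝ) : Prop :=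
  (∀ a b, IntervalIntegrable g volume a b) ∧ ∀ x, f x = f 0 + ∫ t in (0 : ℝ)..x, g t

namespace IsPrim

variable {f g f₁ g₁ S : ℝ → ℝ}

lemma integral_eq (h : IsPrim f g) (a b : ℝ) : ∫ t in a..b, g t = f b - f a := by
  rw [h.2 b, h.2 a, ← intervalIntegral.integral_add_adjacent_intervals (h.1 a 0) (h.1 0 b),
    intervalIntegral.integral_symm]
  ring

lemma ac (h : IsPrim f g) (a b : ℝ) : AbsolutelyContinuousOnInterval f a b := by
  have h1 := (h.1 a b).absolutelyContinuousOnInterval_intervalIntegral (c := a) (by simp)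
  have h2 : AbsolutelyContinuousOnInterval (fun _ : ℝ => f a) a b :=
    (LipschitzOnWith.absolutelyContinuousOnInterval (K := 0)
      (LipschitzWith.const (f a)).lipschitzOnWith)
  have h3 := h2.fun_add h1
  convert! h3 using 2 with x
  rw [h.integral_eq]; ring

lemma continuous (h : IsPrim f g) : Continuous f := by
  have : f = fun x => f 0 + ∫ t in (0 : ℝ)..x, g t := funext h.2
  rw [this]
  exact continuous_const.add (intervalIntegral.continuous_primitive h.1 0)

lemma ae_hasDerivAt (h : IsPrim f g) : ∀ᵐ x, HasDerivAt f (g x) x := by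
  have key : ∀ n : ℕ, ∀ᵐ x, x ∈ uIcc (-(n : ℝ)) n → HasDerivAt f (g x) x := by
    intro n
    filter_upwards [(h.1 (-(n : ℝ)) n).ae_hasDerivAt_integral] with x hx hxn
    have := (hx hxn (-(n : ℝ)) (by simp)).const_add (f (-(n : ℝ)))
    convert! this using 2 with y
    rw [h.integral_eq]; ring
  rw [← ae_all_iff] at key
  filter_upwards [key] with x hx
  obtain ⟨n, hn⟩ := exists_nat_ge |x|
  apply hx n
  rw [uIcc_of_le (by linarith [abs_nonneg x])]
  exact abs_le.1 hn

/-- The fundamental theorem of calculus for absolutely continuous functions. Each closure property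
below reduces to stability of absolute continuity and a pointwise derivative rule. -/
lemma of_ac (h : ∀ a b, AbsolutelyContinuousOnInterval f a b)
    (hd : ∀ᵐ x, HasDerivAt f (g x) x) : IsPrim f g := by
  have e : deriv f =ᵐ[volume] g := by
    filter_upwards [hd] with x hx using hx.deriv
  refine ⟨fun a b => (h a b).intervalIntegrable_deriv.congr_ae (ae_restrict_of_ae e), fun x => ?_⟩
  have := (h 0 x).integral_deriv_eq_sub
  rw [← intervalIntegral.integral_congr_ae (e.mono fun y hy _ => hy), this]
  ring

lemma mul (h : IsPrim f g) (h₁ : IsPrim f₁ g₁) :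
    IsPrim (fun x => f x * f₁ x) (fun x => g x * f₁ x + f x * g₁ x) := by
  refine of_ac (fun a b => (h.ac a b).fun_mul (h₁.ac a b)) ?_
  filter_upwards [h.ae_hasDerivAt, h₁.ae_hasDerivAt] with x hx hx₁ using hx.mul hx₁

lemma of_contDiff (hS : ContDiff ℝ 1 S) : IsPrim S (deriv S) :=
  of_ac (fun _ _ => hS.contDiffOn.absolutelyContinuousOnInterval)
    (ae_of_all _ fun x => (hS.differentiable one_ne_zero x).hasDerivAt)

lemma comp (hS : ContDiff ℝ 1 S) (h : IsPrim f g) :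
    IsPrim (fun x => S (f x)) (fun x => deriv S (f x) * g x) := by
  refine of_ac (fun a b => ?_) ?_
  -- On the bounded range of `f` the function `S` is `K`-Lipschitz, so the variation sums of `S ∘ f`
  -- are at most `K` times those of `f`.
  · obtain ⟨C, hC⟩ := (h.ac a b).exists_bound
    obtain ⟨K, hK⟩ := (hS.contDiffOn (s := Icc (-C) C)).exists_lipschitzOnWith
      one_ne_zero (convex_Icc _ _) isCompact_Icc
    have hf := h.ac a b
    have hf' := hf
    unfold AbsolutelyContinuousOnInterval at hf ⊢
    refine squeeze_zero' (.of_forall fun t => Finset.sum_nonneg fun i _ => dist_nonneg) ?_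
      (by simpa using hf.const_mul (K : ℝ))
    have : AbsolutelyContinuousOnInterval.disjWithin a b ∈
        AbsolutelyContinuousOnInterval.totalLengthFilter ⊓
          𝓟 (AbsolutelyContinuousOnInterval.disjWithin a b) :=
      mem_inf_of_right (mem_principal_self _)
    filter_upwards [this] with E hE
    rw [Finset.mul_sum]
    refine Finset.sum_le_sum fun i hi => hK.dist_le_mul _ ?_ _ ?_
    · exact abs_le.1 (hC _ (hE.1 i hi).1)
    · exact abs_le.1 (hC _ (hE.1 i hi).2)
  · filter_upwards [h.ae_hasDerivAt] with x hx
    exact ((hS.differentiable one_ne_zero (f x)).hasDerivAt).comp x hx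

lemma add (h : IsPrim f g) (h₁ : IsPrim f₁ g₁) :
    IsPrim (fun x => f x + f₁ x) (fun x => g x + g₁ x) := by
  refine of_ac (fun a b => (h.ac a b).fun_add (h₁.ac a b)) ?_
  filter_upwards [h.ae_hasDerivAt, h₁.ae_hasDerivAt] with x hx hx₁ using hx.add hx₁

lemma const_mul (c : ℝ) (h : IsPrim f g) :
    IsPrim (fun x => c * f x) (fun x => c * g x) := by
  refine of_ac (fun a b => (h.ac a b).const_mul c) ?_
  filter_upwards [h.ae_hasDerivAt] with x hx using hx.const_mul c

lemma hasDerivAt (h : IsPrim f g) (hg : Continuous g) (x : ℝ) : HasDerivAt f (g x) x := by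
  have : f = fun x => f 0 + ∫ t in (0 : ℝ)..x, g t := funext h.2
  rw [this]
  exact (intervalIntegral.integral_hasDerivAt_right (h.1 0 x)
    hg.stronglyMeasurable.stronglyMeasurableAtFilter hg.continuousAt).const_add _

end IsPrim

/-- The primitive of `g` with value `c` at `0`. -/
noncomputable def prim (c : ℝ) (g : ℝ → ℝ) (x : ℝ) : ℝ := c + ∫ t in (0 : ℝ)..x, g t

lemma prim_zero (c : ℝ) (g : ℝ → ℝ) : prim c g 0 = c := by simp [prim]

lemma isPrim_prim (c : ℝ) {g : ℝ → ℝ} (hg : ∀ a b, IntervalIntegrable g volume a b) :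
    IsPrim (prim c g) g := ⟨hg, fun x => by simp [prim]⟩

lemma isPrim_prim_of_continuous (c : ℝ) {g : ℝ → ℝ} (hg : Continuous g) :
    IsPrim (prim c g) g := isPrim_prim c fun a b => hg.intervalIntegrable a b

lemma setIntegral_unit (g : ℝ → ℝ) : ∫ x in Ioo (0 : ℝ) 1, g x = ∫ x in (0 : ℝ)..1, g x := by
  rw [intervalIntegral.integral_of_le zero_le_one, integral_Ioc_eq_integral_Ioo]

/-! ### Test functions and weak derivatives -/

lemma IsTestFun.isPrim {φ : ℝ → ℝ} (h : IsTestFun φ) : IsPrim φ (deriv φ) :=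
  IsPrim.of_contDiff (h.smooth.of_le (by exact_mod_cast le_top))

lemma IsTestFun.eq_zero {φ : ℝ → ℝ} (h : IsTestFun φ) {x : ℝ} (hx : x ∉ Ioo (0 : ℝ) 1) :
    φ x = 0 :=
  image_eq_zero_of_notMem_tsupport fun hx' => hx (h.supp hx')

lemma IsTestFun.deriv_testFun {φ : ℝ → ℝ} (h : IsTestFun φ) : IsTestFun (deriv φ) where
  smooth := (contDiff_infty_iff_deriv.1 h.smooth).2
  compact := h.compact.deriv
  supp := (tsupport_deriv_subset).trans h.supp

lemma IsTestFun.sub_const_mul {φ ψ : ℝ → ℝ} (h : IsTestFun φ) (h' : IsTestFun ψ) (c : ℝ) :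
    IsTestFun (fun x => φ x - c * ψ x) where
  smooth := h.smooth.sub (contDiff_const.mul h'.smooth)
  compact := h.compact.sub (h'.compact.mul_left (f := fun _ => c))
  supp := by
    refine (tsupport_sub φ (fun x => c * ψ x)).trans (union_subset h.supp ?_)
    exact (tsupport_mul_subset_right (f := fun _ => c)).trans h'.supp

/-- A test function with vanishing integral has an antiderivative that is a test function. -/
lemma IsTestFun.exists_antideriv {ψ : ℝ → ℝ} (h : IsTestFun ψ)
    (h0 : ∫ x in (0 : ℝ)..1, ψ x = 0) : IsTestFun (prim 0 ψ) ∧ deriv (prim 0 ψ) = ψ := by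
  have hP := isPrim_prim_of_continuous 0 h.smooth.continuous
  have hd : deriv (prim 0 ψ) = ψ :=
    funext fun x => (hP.hasDerivAt h.smooth.continuous x).deriv
  have hdiff : Differentiable ℝ (prim 0 ψ) :=
    fun x => (hP.hasDerivAt h.smooth.continuous x).differentiableAt
  refine ⟨?_, hd⟩
  have hsup : ∃ a b : ℝ, 0 < a ∧ b < 1 ∧ tsupport ψ ⊆ Icc a b := by
    rcases (tsupport ψ).eq_empty_or_nonempty with he | hne
    · exact ⟨1, 0, one_pos, zero_lt_one, by simp [he]⟩
    · have hc : IsCompact (tsupport ψ) := h.compact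
      exact ⟨sInf (tsupport ψ), sSup (tsupport ψ), (h.supp (hc.sInf_mem hne)).1,
        (h.supp (hc.sSup_mem hne)).2,
        fun x hx => ⟨csInf_le hc.bddBelow hx, le_csSup hc.bddAbove hx⟩⟩
  obtain ⟨a, b, ha, hb, hab⟩ := hsup
  have hz : ∀ x, x ∉ Icc a b → ψ x = 0 := fun x hx =>
    image_eq_zero_of_notMem_tsupport fun hx' => hx (hab hx')
  have hsupp : Function.support (prim 0 ψ) ⊆ Icc a b := by
    intro x hx
    by_contra hxn
    apply hx
    have hx' : x < a ∨ b < x := by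
      by_contra! hcon
      exact hxn hcon
    rcases hx' with hx' | hx'
    · rw [prim, zero_add]
      refine intervalIntegral.integral_zero_ae (ae_of_all _ fun y hy => hz y fun hy' => ?_)
      rcases le_total 0 x with h0x | h0x
      · rw [uIoc_of_le h0x] at hy
        linarith [hy.2, hy'.1]
      · rw [uIoc_of_ge h0x] at hy
        linarith [hy.2, hy'.1]
    -- Right of the support the primitive equals its value at `1`, which is zero by the vanishing
    -- mean.
    · have e := hP.integral_eq x 1
      have e1 : prim 0 ψ 1 = 0 := by simp [prim, h0]
      have : ∫ t in x..1, ψ t = 0 := by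
        refine intervalIntegral.integral_zero_ae (ae_of_all _ fun y hy => hz y fun hy' => ?_)
        rcases le_total x 1 with h0x | h0x
        · rw [uIoc_of_le h0x] at hy
          linarith [hy.1, hy'.2]
        · rw [uIoc_of_ge h0x] at hy
          linarith [hy.1, hy'.2]
      linarith
  have hts : tsupport (prim 0 ψ) ⊆ Icc a b := closure_minimal hsupp isClosed_Icc
  exact ⟨contDiff_infty_iff_deriv.2 ⟨hdiff, by rw [hd]; exact h.smooth⟩,
    isCompact_Icc.of_isClosed_subset (isClosed_tsupport _) hts,
    hts.trans fun x hx => ⟨ha.trans_le hx.1, hx.2.trans_lt hb⟩⟩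

lemma integral_unit_eq {φ : ℝ → ℝ} (h : ∀ x, x ∉ Ioo (0 : ℝ) 1 → φ x = 0) :
    ∫ x in Ioo (0 : ℝ) 1, φ x = ∫ x, φ x :=
  setIntegral_eq_integral_of_forall_compl_eq_zero h

lemma exists_testFun_integral_mul_eq_one {a b : ℝ} (ha : 0 ≤ a) (hab : a < b) (hb : b ≤ 1)
    {K : ℝ → ℝ} (hK : Continuous K) (hpos : ∀ x ∈ Ioo a b, 0 < K x) :
    ∃ ρ, IsTestFun ρ ∧ tsupport ρ ⊆ Ioo a b ∧ ∫ x in Ioo (0 : ℝ) 1, ρ x * K x = 1 := by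
  let β : ContDiffBump ((a + b) / 2) := ⟨(b - a) / 8, (b - a) / 4, by linarith, by linarith⟩
  have hβs : tsupport β ⊆ Ioo a b := by
    rw [β.tsupport_eq]
    intro x hx
    rw [Real.closedBall_eq_Icc] at hx
    have h1 := hx.1
    have h2 := hx.2
    simp only [β] at h1 h2
    constructor <;> linarith
  have hsub : Ioo a b ⊆ Ioo 0 1 := Ioo_subset_Ioo ha hb
  have hβ : IsTestFun β := ⟨β.contDiff, β.hasCompactSupport, hβs.trans hsub⟩
  have hI : 0 < ∫ x in Ioo (0 : ℝ) 1, β x * K x := by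
    rw [integral_unit_eq fun x hx => by rw [hβ.eq_zero hx, zero_mul]]
    refine Continuous.integral_pos_of_hasCompactSupport_nonneg_nonzero (x := (a + b) / 2)
      (β.continuous.mul hK) (β.hasCompactSupport.mul_right) (fun x => ?_) ?_
    · by_cases hx : x ∈ tsupport β
      · exact mul_nonneg β.nonneg (hpos x (hβs hx)).le
      · simp [image_eq_zero_of_notMem_tsupport hx]
    · have : β ((a + b) / 2) = 1 :=
        β.one_of_mem_closedBall (Metric.mem_closedBall_self β.rIn_pos.le)
      rw [this, one_mul]
      exact (hpos _ ⟨by linarith, by linarith⟩).ne'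
  set I := ∫ x in Ioo (0 : ℝ) 1, β x * K x
  refine ⟨fun x => I⁻¹ * β x, ⟨contDiff_const.mul β.contDiff,
    β.hasCompactSupport.mul_left (f := fun _ => I⁻¹),
    (tsupport_mul_subset_right (f := fun _ => I⁻¹)).trans hβ.supp⟩,
    (tsupport_mul_subset_right (f := fun _ => I⁻¹)).trans hβs, ?_⟩
  simp_rw [mul_assoc]
  rw [integral_const_mul, inv_mul_cancel₀ hI.ne']

lemma integrable_mul_of_tsupport_subset {d ζ : ℝ → ℝ} {U : Set ℝ} (hd : LocallyIntegrableOn d U)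
    (hζ : Continuous ζ) (hc : HasCompactSupport ζ) (hs : tsupport ζ ⊆ U) :
    Integrable (fun x => ζ x * d x) := by
  have h1 : IntegrableOn d (tsupport ζ) := hd.integrableOn_compact_subset hs hc
  have h2 : IntegrableOn (fun x => ζ x * d x) (tsupport ζ) :=
    h1.continuousOn_mul hζ.continuousOn hc
  refine (integrableOn_iff_integrable_of_support_subset ?_).1 h2
  exact (Function.support_mul_subset_left _ _).trans (subset_tsupport _)

/-- Du Bois-Reymond lemma with a weight `K`. -/
lemma ae_eq_const_mul_of_orthogonal {a b : ℝ} (ha : 0 ≤ a) (hab : a < b) (hb : b ≤ 1)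
    {K d : ℝ → ℝ} (hK : Continuous K) (hpos : ∀ x ∈ Ioo a b, 0 < K x)
    (hd : LocallyIntegrableOn d (Ioo a b))
    (h : ∀ ζ, IsTestFun ζ → tsupport ζ ⊆ Ioo a b → ∫ x in Ioo (0 : ℝ) 1, ζ x * K x = 0 →
      ∫ x in Ioo (0 : ℝ) 1, ζ x * d x = 0) :
    ∃ c : ℝ, ∀ᵐ x, x ∈ Ioo a b → d x = c * K x := by
  obtain ⟨ρ, hρ, hρs, hρK⟩ := exists_testFun_integral_mul_eq_one ha hab hb hK hpos
  have hsub : Ioo a b ⊆ Ioo 0 1 := Ioo_subset_Ioo ha hb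
  -- The only possible constant: pair `d = c K` with `ρ`, which is normalised by `∫ ρ K = 1`.
  set c := ∫ x in Ioo (0 : ℝ) 1, ρ x * d x with hc
  have hKl : LocallyIntegrableOn K (Ioo a b) := hK.locallyIntegrable.locallyIntegrableOn _
  have key : ∀ᵐ x, x ∈ Ioo a b → d x - c * K x = 0 := by
    refine isOpen_Ioo.ae_eq_zero_of_integral_contDiff_smul_eq_zero
      (hd.sub (hKl.smul c)) fun g hg hgc hgs => ?_
    have hgt : IsTestFun g := ⟨hg, hgc, hgs.trans hsub⟩
    have i1 := integrable_mul_of_tsupport_subset hd hg.continuous hgc hgs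
    have i2 := integrable_mul_of_tsupport_subset hKl hg.continuous hgc hgs
    have i3 := integrable_mul_of_tsupport_subset hd hρ.smooth.continuous hρ.compact hρs
    have i4 := integrable_mul_of_tsupport_subset hKl hρ.smooth.continuous hρ.compact hρs
    set e := ∫ x in Ioo (0 : ℝ) 1, g x * K x with he
    -- Subtracting `e ρ` makes an arbitrary `g` orthogonal to `K`; the hypothesis then yields `∫ g d
    -- = e c = c ∫ g K`.
    have hts : tsupport (fun x => g x - e * ρ x) ⊆ Ioo a b :=
      (tsupport_sub g (fun x => e * ρ x)).trans (union_subset hgs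
        ((tsupport_mul_subset_right (f := fun _ => e)).trans hρs))
    have h1 := h _ (hgt.sub_const_mul hρ e) hts (by
      simp_rw [sub_mul, mul_assoc]
      rw [integral_sub i2.integrableOn (i4.integrableOn.const_mul e), integral_const_mul, hρK]
      ring)
    simp_rw [sub_mul, mul_assoc] at h1
    rw [integral_sub i1.integrableOn (i3.integrableOn.const_mul e), integral_const_mul,
      ← hc] at h1
    rw [← integral_unit_eq fun x hx => by simp [hgt.eq_zero hx]]
    have : ∀ x, g x • (d x - c * K x) = g x * d x - c * (g x * K x) := fun x => by
      simp only [smul_eq_mul]; ring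
    simp_rw [this]
    rw [integral_sub i1.integrableOn (i2.integrableOn.const_mul c), integral_const_mul]
    linarith
  refine ⟨c, key.mono fun x hx hx' => by linarith [hx hx']⟩

lemma ae_unit_iff {P : ℝ → Prop} : (∀ᵐ x ∂unitVol, P x) ↔ ∀ᵐ x, x ∈ Ioo (0 : ℝ) 1 → P x :=
  ae_restrict_iff' measurableSet_Ioo

lemma IsWeakDeriv.ae_unique {f g g' : ℝ → ℝ} (h : IsWeakDeriv f g) (h' : IsWeakDeriv f g') :
    g =ᵐ[unitVol] g' := by
  have key : ∀ᵐ x, x ∈ Ioo (0 : ℝ) 1 → g x - g' x = 0 := by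
    refine isOpen_Ioo.ae_eq_zero_of_integral_contDiff_smul_eq_zero
      (h.locInt'.sub h'.locInt') fun φ hφ hc hs => ?_
    have hφt : IsTestFun φ := ⟨hφ, hc, hs⟩
    rw [← integral_unit_eq fun x hx => by simp [hφt.eq_zero hx]]
    have i1 := integrable_mul_of_tsupport_subset h.locInt' hφ.continuous hc hs
    have i2 := integrable_mul_of_tsupport_subset h'.locInt' hφ.continuous hc hs
    have e1 := h.integral_eq φ hφt
    have e2 := h'.integral_eq φ hφt
    simp_rw [mul_comm _ (φ _)] at e1 e2
    simp_rw [smul_eq_mul, mul_sub]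
    rw [integral_sub i1.integrableOn i2.integrableOn]
    linarith
  exact ae_unit_iff.2 (key.mono fun x hx hx' => by linarith [hx hx'])

lemma isWeakDeriv_weakDeriv {f g : ℝ → ℝ} (h : IsWeakDeriv f g) :
    IsWeakDeriv f (weakDeriv f) := by
  have h' : ∃ g, IsWeakDeriv f g := ⟨g, h⟩
  rw [weakDeriv, dif_pos h']
  exact h'.choose_spec

lemma IsWeakDeriv.weakDeriv_ae_eq {f g : ℝ → ℝ} (h : IsWeakDeriv f g) :
    weakDeriv f =ᵐ[unitVol] g := (isWeakDeriv_weakDeriv h).ae_unique h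

lemma locallyIntegrableOn_congr {f f' : ℝ → ℝ} (hf : f =ᵐ[unitVol] f')
    (h : LocallyIntegrableOn f (Ioo (0 : ℝ) 1)) : LocallyIntegrableOn f' (Ioo (0 : ℝ) 1) := by
  rw [locallyIntegrableOn_iff isOpen_Ioo.isLocallyClosed] at h ⊢
  intro k hk hkc
  exact (h k hk hkc).congr_fun_ae (ae_restrict_of_ae_restrict_of_subset hk hf)

lemma IsWeakDeriv.congr {f f' g g' : ℝ → ℝ} (h : IsWeakDeriv f g) (hf : f =ᵐ[unitVol] f')
    (hg : g =ᵐ[unitVol] g') : IsWeakDeriv f' g' where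
  locInt := locallyIntegrableOn_congr hf h.locInt
  locInt' := locallyIntegrableOn_congr hg h.locInt'
  integral_eq φ hφ := by
    rw [← integral_congr_ae (hf.mono fun x hx => by simp only [hx] :
        (fun x => f x * deriv φ x) =ᵐ[unitVol] fun x => f' x * deriv φ x),
      ← integral_congr_ae (hg.mono fun x hx => by simp only [hx] :
        (fun x => g x * φ x) =ᵐ[unitVol] fun x => g' x * φ x)]
    exact h.integral_eq φ hφ

lemma IsPrim.isWeakDeriv {f g : ℝ → ℝ} (h : IsPrim f g) : IsWeakDeriv f g where
  locInt := h.continuous.locallyIntegrable.locallyIntegrableOn _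
  locInt' := by
    refine LocallyIntegrable.locallyIntegrableOn ?_ _
    exact (locallyIntegrable_iff.2 fun k hk => by
      obtain ⟨a, b, hab⟩ : ∃ a b : ℝ, k ⊆ Icc a b :=
        ⟨_, _, hk.isBounded.subset_Icc_sInf_sSup⟩
      rcases le_total a b with hle | hle
      · exact ((intervalIntegrable_iff_integrableOn_Icc_of_le hle).1 (h.1 a b)).mono_set hab
      · rcases hle.lt_or_eq with hlt | heq
        · rw [Icc_eq_empty (not_le.2 hlt)] at hab
          simp [subset_empty_iff.1 hab]
        · exact ((intervalIntegrable_iff_integrableOn_Icc_of_le heq.ge).1 (h.1 a b)).mono_set hab)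
  integral_eq φ hφ := by
    have hm := (h.mul hφ.isPrim).integral_eq 0 1
    rw [hφ.eq_zero (by simp), hφ.eq_zero (by simp)] at hm
    have hc : Continuous (deriv φ) := hφ.deriv_testFun.smooth.continuous
    rw [intervalIntegral.integral_add ((h.1 0 1).mul_continuousOn hφ.smooth.continuous.continuousOn)
      (Continuous.intervalIntegrable (u := fun x => f x * deriv φ x)
        (h.continuous.mul hc) 0 1)] at hm
    rw [setIntegral_unit, setIntegral_unit]
    linarith

/-- A function with integrable weak derivative agrees a.e. with a primitive of it. -/
lemma IsWeakDeriv.ae_eq_prim {f g : ℝ → ℝ} (h : IsWeakDeriv f g)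
    (hg : ∀ a b, IntervalIntegrable g volume a b) : ∃ c, f =ᵐ[unitVol] prim c g := by
  have hw := (isPrim_prim 0 hg).isWeakDeriv
  -- With weight `1`, orthogonality need only be tested on mean-zero `ζ`, and these are derivatives
  -- of test functions.
  obtain ⟨c, hc⟩ := ae_eq_const_mul_of_orthogonal (a := 0) (b := 1) le_rfl one_pos le_rfl
    (K := fun _ => 1) (d := fun x => f x - prim 0 g x) continuous_const (fun _ _ => one_pos)
    (h.locInt.sub hw.locInt) (fun ζ hζ hζs h0 => by
      simp only [mul_one] at h0
      rw [setIntegral_unit] at h0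
      obtain ⟨hφ, hd⟩ := hζ.exists_antideriv h0
      have e1 := h.integral_eq _ hφ
      have e2 := hw.integral_eq _ hφ
      rw [hd] at e1 e2
      simp_rw [mul_comm _ (ζ _)] at e1 e2
      have i1 := integrable_mul_of_tsupport_subset h.locInt hζ.smooth.continuous hζ.compact hζ.supp
      have i2 := integrable_mul_of_tsupport_subset hw.locInt hζ.smooth.continuous hζ.compact hζ.supp
      simp_rw [mul_sub]
      rw [integral_sub i1.integrableOn i2.integrableOn, e1, e2, sub_self])
  refine ⟨c, ae_unit_iff.2 (hc.mono fun x hx hx' => ?_)⟩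
  have := hx hx'
  simp only [prim] at this ⊢
  linarith

/-! ### Sobolev estimates and approximation by test functions -/

instance : IsProbabilityMeasure unitVol := ⟨by simp⟩

lemma one_le_ofReal {p : ℝ} (hp : 1 < p) : 1 ≤ ENNReal.ofReal p := by
  rw [← ENNReal.ofReal_one]
  exact ENNReal.ofReal_le_ofReal hp.le

lemma ofReal_integral_abs_le {p : ℝ} (hp : 1 < p) {d : ℝ → ℝ}
    (hd : IntegrableOn d (Ioo (0 : ℝ) 1)) :
    ENNReal.ofReal (∫ x in (0 : ℝ)..1, |d x|) ≤ eLpNorm d (ENNReal.ofReal p) unitVol := by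
  rw [← setIntegral_unit]
  have h1 := ofReal_integral_norm_eq_lintegral_enorm hd
  simp only [Real.norm_eq_abs] at h1
  rw [h1, ← eLpNorm_one_eq_lintegral_enorm]
  exact eLpNorm_le_eLpNorm_of_exponent_le (one_le_ofReal hp) hd.aestronglyMeasurable

lemma IsPrim.integrableOn {f g : ℝ → ℝ} (h : IsPrim f g) : IntegrableOn g (Ioo (0 : ℝ) 1) :=
  ((intervalIntegrable_iff_integrableOn_Ioc_of_le zero_le_one).1 (h.1 0 1)).mono_set
    Ioo_subset_Ioc_self

lemma IsPrim.abs_sub_le {f g : ℝ → ℝ} (h : IsPrim f g) {x y : ℝ} (hx : x ∈ Icc (0 : ℝ) 1)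
    (hy : y ∈ Icc (0 : ℝ) 1) : |f y - f x| ≤ ∫ t in (0 : ℝ)..1, |g t| := by
  rw [← h.integral_eq]
  have h1 : |∫ t in x..y, g t| ≤ ∫ t in uIoc x y, |g t| := by
    simpa only [Real.norm_eq_abs] using
      intervalIntegral.norm_integral_le_integral_norm_uIoc (f := g) (a := x) (b := y)
  refine h1.trans ?_
  rw [intervalIntegral.integral_of_le zero_le_one]
  refine setIntegral_mono_set (h.1 0 1).abs.1 (ae_of_all _ fun _ => abs_nonneg _)
    (LE.le.eventuallyLE ?_)
  exact Ioc_subset_Ioc (le_min hx.1 hy.1) (max_le hx.2 hy.2)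

/-- Boundary values are controlled by the Sobolev norm. -/
lemma IsPrim.ofReal_abs_le {p : ℝ} (hp : 1 < p) {f g : ℝ → ℝ} (h : IsPrim f g) {x : ℝ}
    (hx : x ∈ Icc (0 : ℝ) 1) : ENNReal.ofReal |f x| ≤
      eLpNorm f (ENNReal.ofReal p) unitVol + eLpNorm g (ENNReal.ofReal p) unitVol := by
  have hf : IntegrableOn f (Ioo (0 : ℝ) 1) :=
    (h.continuous.integrableOn_Icc).mono_set Ioo_subset_Icc_self
  refine le_trans ?_ (add_le_add (ofReal_integral_abs_le hp hf)
    (ofReal_integral_abs_le hp h.integrableOn))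
  rw [← ENNReal.ofReal_add (intervalIntegral.integral_nonneg zero_le_one fun _ _ => abs_nonneg _)
    (intervalIntegral.integral_nonneg zero_le_one fun _ _ => abs_nonneg _)]
  refine ENNReal.ofReal_le_ofReal ?_
  -- Average `|f x| - ∫ |g| ≤ |f y|` over `y`.
  have hmono : ∫ y in (0 : ℝ)..1, (|f x| - ∫ t in (0 : ℝ)..1, |g t|) ≤ ∫ y in (0 : ℝ)..1, |f y| := by
    refine intervalIntegral.integral_mono_on zero_le_one (by simp)
      (h.continuous.abs.intervalIntegrable 0 1) fun y hy => ?_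
    have := h.abs_sub_le hx hy
    have h2 := abs_sub_abs_le_abs_sub (f x) (f y)
    rw [abs_sub_comm] at h2
    linarith
  simp at hmono
  linarith

/-- A smooth approximation on the line is cut off near the end points; the loss lives on a boundary
layer of small measure and is controlled by uniform integrability. -/
lemma exists_testFun_eLpNorm_sub_le {p : ℝ} (hp : 1 < p) {v : ℝ → ℝ}
    (hv : MemLp v (ENNReal.ofReal p) unitVol) {ε : ℝ} (hε : 0 < ε) :
    ∃ φ, IsTestFun φ ∧ eLpNorm (v - φ) (ENNReal.ofReal p) unitVol ≤ ENNReal.ofReal ε := by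
  have hp1 := one_le_ofReal hp
  obtain ⟨g, hgc, hg, hvg⟩ := hv.exist_eLpNorm_sub_le ENNReal.ofReal_ne_top hp1 (half_pos hε)
  have hgL : MemLp g (ENNReal.ofReal p) unitVol := hg.continuous.memLp_of_hasCompactSupport hgc
  obtain ⟨δ, hδ, hgδ⟩ := hgL.eLpNorm_indicator_le hp1 ENNReal.ofReal_ne_top (half_pos hε)
  -- Two layers of width `r` have total measure at most `δ`; the bound `1 / 4` keeps the radii of
  -- the cutoff positive.
  set r := min (δ / 2) (1 / 4) with hr
  have hr0 : 0 < r := by positivity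
  have hr1 : r ≤ 1 / 4 := min_le_right _ _
  have hr2 : r ≤ δ / 2 := min_le_left _ _
  let χ : ContDiffBump (1 / 2 : ℝ) := ⟨1 / 2 - r, 1 / 2 - r / 2, by linarith, by linarith⟩
  have hχs : tsupport χ ⊆ Ioo 0 1 := by
    rw [χ.tsupport_eq]
    intro x hx
    rw [Real.closedBall_eq_Icc] at hx
    have h1 := hx.1
    have h2 := hx.2
    simp only [χ] at h1 h2
    constructor <;> linarith
  have hφ : IsTestFun (fun x => χ x * g x) := ⟨χ.contDiff.mul hg, χ.hasCompactSupport.mul_right,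
    (tsupport_mul_subset_left).trans hχs⟩
  refine ⟨_, hφ, ?_⟩
  set S : Set ℝ := (Icc r (1 - r))ᶜ with hS
  have hSm : MeasurableSet S := measurableSet_Icc.compl
  have hSv : unitVol S ≤ ENNReal.ofReal δ := by
    rw [Measure.restrict_apply hSm]
    calc volume (S ∩ Ioo 0 1) ≤ volume (Ioo 0 r ∪ Ioo (1 - r) 1) := by
          refine measure_mono fun x hx => ?_
          by_cases hxr : x < r
          · exact Or.inl ⟨hx.2.1, hxr⟩
          · refine Or.inr ⟨?_, hx.2.2⟩
            by_contra hcon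
            exact hx.1 ⟨not_lt.1 hxr, not_lt.1 hcon⟩
      _ ≤ volume (Ioo 0 r) + volume (Ioo (1 - r) 1) := measure_union_le _ _
      _ ≤ ENNReal.ofReal δ := by
          rw [Real.volume_Ioo, Real.volume_Ioo, ← ENNReal.ofReal_add (by linarith) (by linarith)]
          exact ENNReal.ofReal_le_ofReal (by linarith)
  have h2 : eLpNorm (g - fun x => χ x * g x) (ENNReal.ofReal p) unitVol ≤
      ENNReal.ofReal (ε / 2) := by
    refine (eLpNorm_mono fun x => ?_).trans (hgδ S hSm hSv)
    by_cases hx : x ∈ S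
    · rw [indicator_of_mem hx, Pi.sub_apply, Real.norm_eq_abs, Real.norm_eq_abs,
        show g x - χ x * g x = (1 - χ x) * g x by ring, abs_mul]
      refine mul_le_of_le_one_left (abs_nonneg _) ?_
      rw [abs_le]
      constructor <;> linarith [χ.nonneg (x := x), χ.le_one (x := x)]
    · have hx' : x ∈ Icc r (1 - r) := by simpa [hS] using hx
      have : χ x = 1 := χ.one_of_mem_closedBall (by
        rw [Real.closedBall_eq_Icc]
        simp only [χ]
        exact ⟨by linarith [hx'.1], by linarith [hx'.2]⟩)
      simp [this]
  have : v - (fun x => χ x * g x) = (v - g) + (g - fun x => χ x * g x) := by simp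
  rw [this]
  refine (eLpNorm_add_le (hv.sub hgL).1
    (hgL.1.sub hφ.smooth.continuous.aestronglyMeasurable) hp1).trans ?_
  refine (add_le_add hvg h2).trans ?_
  rw [← ENNReal.ofReal_add (by positivity) (by positivity), add_halves]

/-- Primitives vanishing at both ends are approximated by test functions in the Sobolev norm. -/
lemma IsPrim.exists_testFun_approx {p : ℝ} (hp : 1 < p) {u v : ℝ → ℝ} (h : IsPrim u v)
    (hv : MemLp v (ENNReal.ofReal p) unitVol) (h0 : u 0 = 0) (h1 : u 1 = 0) :
    ∃ C : ℝ≥0∞, C ≠ ⊤ ∧ ∀ ε : ℝ, 0 < ε → ∃ φ, IsTestFun φ ∧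
      eLpNorm (fun x => u x - φ x) (ENNReal.ofReal p) unitVol ≤ ENNReal.ofReal ε * C ∧
      eLpNorm (fun x => v x - deriv φ x) (ENNReal.ofReal p) unitVol ≤ ENNReal.ofReal ε * C := by
  have hp1 := one_le_ofReal hp
  obtain ⟨ρ, hρ, -, hρ1⟩ := exists_testFun_integral_mul_eq_one le_rfl one_pos le_rfl
    (K := fun _ => 1) continuous_const (fun _ _ => one_pos)
  simp only [mul_one] at hρ1
  have hρL : MemLp ρ (ENNReal.ofReal p) unitVol :=
    hρ.smooth.continuous.memLp_of_hasCompactSupport hρ.compact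
  refine ⟨1 + eLpNorm ρ (ENNReal.ofReal p) unitVol,
    ENNReal.add_ne_top.2 ⟨ENNReal.one_ne_top, hρL.2.ne⟩, fun ε hε => ?_⟩
  -- Approximate the derivative and subtract `e ρ`, where `e` is the mean, so that the
  -- antiderivative is again a test function. Since `v` has mean zero, `|e| ≤ ε`.
  obtain ⟨ψ, hψ, hvψ⟩ := exists_testFun_eLpNorm_sub_le hp hv hε
  have hψi : IntervalIntegrable ψ volume 0 1 := hψ.smooth.continuous.intervalIntegrable 0 1
  have hρi : IntervalIntegrable ρ volume 0 1 := hρ.smooth.continuous.intervalIntegrable 0 1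
  set e := ∫ x in (0 : ℝ)..1, ψ x with he
  rw [setIntegral_unit] at hρ1
  obtain ⟨hφ, hφd⟩ := (hψ.sub_const_mul hρ e).exists_antideriv (by
    rw [intervalIntegral.integral_sub hψi (hρi.const_mul e), intervalIntegral.integral_const_mul,
      hρ1]
    ring)
  have hee : ‖e‖ₑ ≤ ENNReal.ofReal ε := by
    have e1 : |e| ≤ ∫ x in (0 : ℝ)..1, |(v - ψ) x| := by
      have : e = -∫ x in (0 : ℝ)..1, (v - ψ) x := by
        simp only [Pi.sub_apply]
        rw [intervalIntegral.integral_sub (h.1 0 1) hψi, h.integral_eq, h0, h1]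
        ring
      rw [this, abs_neg]
      exact intervalIntegral.abs_integral_le_integral_abs zero_le_one
    rw [Real.enorm_eq_ofReal_abs]
    refine (ENNReal.ofReal_le_ofReal e1).trans ((ofReal_integral_abs_le hp ?_).trans hvψ)
    exact h.integrableOn.sub
      ((hψ.smooth.continuous.integrableOn_Icc).mono_set Ioo_subset_Icc_self)
  have hd : eLpNorm (fun x => v x - deriv (prim 0 fun x => ψ x - e * ρ x) x) (ENNReal.ofReal p)
      unitVol ≤ ENNReal.ofReal ε * (1 + eLpNorm ρ (ENNReal.ofReal p) unitVol) := by
    rw [hφd]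
    have : (fun x => v x - (ψ x - e * ρ x)) = (v - ψ) + e • ρ := by
      ext x; simp; ring
    rw [this]
    refine (eLpNorm_add_le (hv.1.sub hψ.smooth.continuous.aestronglyMeasurable)
      (hρL.1.const_smul e) hp1).trans ?_
    rw [eLpNorm_const_smul, mul_add, mul_one]
    gcongr
  refine ⟨_, hφ, le_trans ?_ hd, hd⟩
  -- The difference vanishes at `0`, so its sup norm is at most the `L¹` norm of its derivative.
  have hP : IsPrim (fun x => u x - prim 0 (fun x => ψ x - e * ρ x) x)
      (fun x => v x - deriv (prim 0 fun x => ψ x - e * ρ x) x) := by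
    simpa [sub_eq_add_neg] using h.add (hφ.isPrim.const_mul (-1))
  refine le_trans ?_ (ofReal_integral_abs_le hp hP.integrableOn)
  refine (eLpNorm_le_of_ae_bound (C := ∫ x in (0 : ℝ)..1,
    |v x - deriv (prim 0 fun x => ψ x - e * ρ x) x|) ?_).trans (by simp)
  refine ae_unit_iff.2 (ae_of_all _ fun x hx => ?_)
  have := hP.abs_sub_le (x := 0) (y := x) (by simp) ⟨hx.1.le, hx.2.le⟩
  rwa [h0, prim_zero, sub_zero, sub_zero] at this

/-! ### Reduction of the variational problem to profiles -/

/-- Functions of `M(ψ)`, described by their first and second derivatives. -/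
structure IsProfile (p : ℝ) (ψ u v z : ℝ → ℝ) : Prop where
  prim_u : IsPrim u v
  prim_v : IsPrim v z
  memLp : MemLp z (ENNReal.ofReal p) unitVol
  left : u 0 = 0
  right : u 1 = 0
  le : ∀ x ∈ Icc (0 : ℝ) 1, ψ x ≤ u x

lemma memLp_of_continuous {f : ℝ → ℝ} (hf : Continuous f) (q : ℝ≥0∞) : MemLp f q unitVol := by
  obtain ⟨C, hC⟩ := isCompact_Icc.exists_bound_of_continuousOn (s := Icc (0 : ℝ) 1) hf.continuousOn
  exact MemLp.of_bound hf.aestronglyMeasurable C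
    (ae_unit_iff.2 (ae_of_all _ fun x hx => hC x (Ioo_subset_Icc_self hx)))

lemma IsProfile.weakDeriv_ae_eq {p : ℝ} {ψ u v z : ℝ → ℝ} (h : IsProfile p ψ u v z) :
    weakDeriv u =ᵐ[unitVol] v := h.prim_u.isWeakDeriv.weakDeriv_ae_eq

lemma IsProfile.mem_admissible {p : ℝ} (hp : 1 < p) {ψ u v z : ℝ → ℝ} (h : IsProfile p ψ u v z) :
    u ∈ admissible p ψ := by
  have hvL := memLp_of_continuous h.prim_v.continuous (ENNReal.ofReal p)
  have hw := h.weakDeriv_ae_eq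
  have hW1 : MemW1 p u :=
    ⟨memLp_of_continuous h.prim_u.continuous _, v, h.prim_u.isWeakDeriv, hvL⟩
  refine ⟨h.prim_u.continuous.continuousOn, ⟨hW1, hvL.ae_eq hw.symm, z,
    h.prim_v.isWeakDeriv.congr hw.symm (ae_eq_refl _), h.memLp⟩, ⟨hW1, ?_⟩, h.le⟩
  obtain ⟨C, hC, happ⟩ := h.prim_u.exists_testFun_approx hp hvL h.left h.right
  choose φ hφ h1 h2 using fun n : ℕ => happ (1 / ((n : ℝ) + 1)) (by positivity)
  have hlim : Tendsto (fun n : ℕ => ENNReal.ofReal (1 / ((n : ℝ) + 1)) * C) atTop (𝓝 0) := by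
    have := ENNReal.Tendsto.mul_const (b := C)
      (ENNReal.tendsto_ofReal tendsto_one_div_add_atTop_nhds_zero_nat) (Or.inr hC)
    simpa using this
  refine ⟨φ, hφ, tendsto_of_tendsto_of_tendsto_of_le_of_le tendsto_const_nhds hlim
    (fun _ => zero_le) h1, tendsto_of_tendsto_of_tendsto_of_le_of_le tendsto_const_nhds hlim
    (fun _ => zero_le) fun n => ?_⟩
  refine le_trans (eLpNorm_congr_ae ?_).le (h2 n)
  filter_upwards [hw] with x hx
  rw [hx]

/-- Integrating the second weak derivative twice recovers `u` a.e., and by continuity everywhere on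
`[0,1]`. The zero boundary values pass to the limit from the approximating test functions. -/
lemma exists_profile {p : ℝ} (hp : 1 < p) {ψ u : ℝ → ℝ} (hu : u ∈ admissible p ψ) :
    ∃ u' v z, IsProfile p ψ u' v z ∧ EqOn u u' (Icc 0 1) ∧ weakDeriv u =ᵐ[unitVol] v := by
  obtain ⟨hc, ⟨⟨-, g₁, hg₁, -⟩, -, g, hg, hgL⟩, ⟨-, φ, hφ, hφ0, hφ1⟩, hle⟩ := hu
  have hp1 := one_le_ofReal hp
  -- Extension by zero makes the second derivative integrable on the whole line, as `IsPrim`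
  -- requires.
  set z : ℝ → ℝ := (Ioo (0 : ℝ) 1).indicator g with hz
  have hzg : z =ᵐ[unitVol] g := ae_unit_iff.2 (ae_of_all _ fun x hx => indicator_of_mem hx g)
  have hzL : MemLp z (ENNReal.ofReal p) unitVol := hgL.ae_eq hzg.symm
  have hzi : Integrable z :=
    (integrable_indicator_iff measurableSet_Ioo).2 (hgL.integrable hp1)
  obtain ⟨A, hA⟩ := (hg.congr (ae_eq_refl _) hzg.symm).ae_eq_prim
    fun a b => hzi.intervalIntegrable
  have hv := isPrim_prim A (g := z) fun a b => hzi.intervalIntegrable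
  obtain ⟨c, hcu⟩ := ((isWeakDeriv_weakDeriv hg₁).congr (ae_eq_refl _) hA).ae_eq_prim
    fun a b => hv.continuous.intervalIntegrable a b
  have hU := isPrim_prim_of_continuous c hv.continuous
  have heq : EqOn u (prim c (prim A z)) (Icc 0 1) := by
    refine Measure.eqOn_Icc_of_ae_eq volume zero_ne_one ?_ hc hU.continuous.continuousOn
    rw [← restrict_Ioo_eq_restrict_Icc]
    exact hcu
  have hbd : ∀ x ∈ Icc (0 : ℝ) 1, x ∉ Ioo (0 : ℝ) 1 → prim c (prim A z) x = 0 := by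
    intro x hx hx'
    have hb : ∀ n, ENNReal.ofReal |prim c (prim A z) x| ≤
        eLpNorm (fun x => u x - φ n x) (ENNReal.ofReal p) unitVol +
        eLpNorm (fun x => weakDeriv u x - deriv (φ n) x) (ENNReal.ofReal p) unitVol := by
      intro n
      have hP : IsPrim (fun x => prim c (prim A z) x - φ n x)
          (fun x => prim A z x - deriv (φ n) x) := by
        simpa [sub_eq_add_neg] using hU.add ((hφ n).isPrim.const_mul (-1))
      have := hP.ofReal_abs_le hp hx
      rw [(hφ n).eq_zero hx', sub_zero] at this
      refine this.trans (add_le_add (eLpNorm_congr_ae ?_).le (eLpNorm_congr_ae ?_).le)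
      · filter_upwards [hcu] with y hy
        rw [hy]
      · filter_upwards [hA] with y hy
        rw [hy]
    have hl := le_of_tendsto_of_tendsto' tendsto_const_nhds (hφ0.add hφ1) hb
    simpa using hl
  refine ⟨_, _, z, ⟨hU, hv, hzL, hbd 0 (by simp) (by simp), hbd 1 (by simp) (by simp),
    fun x hx => (hle x hx).trans (heq hx).le⟩, heq, hA⟩

/-- The energy in terms of the first two derivatives. -/
noncomputable def profileEnergy (p : ℝ) (G v z : ℝ → ℝ) : ℝ :=
  ∫ x in Ioo (0 : ℝ) 1, |deriv G (v x) * z x| ^ p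

lemma energy_eq {p : ℝ} {G u v z : ℝ → ℝ} (hG : ContDiff ℝ ∞ G) (hv : IsPrim v z)
    (hu : weakDeriv u =ᵐ[unitVol] v) : energy p G u = profileEnergy p G v z := by
  have h1 : IsWeakDeriv (fun y => G (weakDeriv u y)) (fun x => deriv G (v x) * z x) :=
    (hv.comp (hG.of_le (by exact_mod_cast le_top))).isWeakDeriv.congr
      (hu.mono fun x hx => by simp only [hx]) (ae_eq_refl _)
  refine integral_congr_ae ?_
  filter_upwards [h1.weakDeriv_ae_eq] with x hx
  rw [hx]

/-- A minimizer among profiles. -/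
def IsProfileMinimizer (p : ℝ) (G ψ u v z : ℝ → ℝ) : Prop :=
  IsProfile p ψ u v z ∧ ∀ u' v' z', IsProfile p ψ u' v' z' →
    profileEnergy p G v z ≤ profileEnergy p G v' z'

lemma IsMinimizer.exists_profile {p : ℝ} (hp : 1 < p) {G ψ u : ℝ → ℝ} (hG : ContDiff ℝ ∞ G)
    (hu : IsMinimizer p G ψ u) :
    ∃ u' v z, IsProfileMinimizer p G ψ u' v z ∧ EqOn u u' (Icc 0 1) := by
  obtain ⟨u', v, z, h, heq, hw⟩ := PElastica.exists_profile hp hu.1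
  refine ⟨u', v, z, ⟨h, fun u₁ v₁ z₁ h₁ => ?_⟩, heq⟩
  rw [← energy_eq hG h.prim_v hw, ← energy_eq hG h₁.prim_v h₁.weakDeriv_ae_eq]
  exact hu.2 _ (h₁.mem_admissible hp)

/-! ### First variation of the energy -/

lemma ContDiff.deriv_infty {G : ℝ → ℝ} (hG : ContDiff ℝ ∞ G) : ContDiff ℝ ∞ (deriv G) :=
  (contDiff_infty_iff_deriv.1 hG).2

/-- The dual field `|f|^{p-2} f` of `f = (G ∘ v)'`. -/
noncomputable def dualField (p : ℝ) (G v z : ℝ → ℝ) (x : ℝ) : ℝ :=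
  |deriv G (v x) * z x| ^ (p - 2) * (deriv G (v x) * z x)

/-- The case `y = 0` is separate because the exponent `p - 2` may be negative. -/
lemma abs_rpow_sub_two_mul_le {p y Q : ℝ} (hp : 1 < p) (hy : |y| ≤ Q) :
    |(|y| ^ (p - 2) * y)| ≤ Q ^ (p - 1) := by
  rcases eq_or_ne y 0 with rfl | h0
  · simpa using Real.rpow_nonneg ((abs_nonneg _).trans hy) _
  · have hy0 : 0 < |y| := abs_pos.2 h0
    rw [abs_mul, abs_of_nonneg (Real.rpow_nonneg hy0.le _)]
    calc |y| ^ (p - 2) * |y| = |y| ^ (p - 2 + 1) := by rw [Real.rpow_add_one hy0.ne']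
      _ = |y| ^ (p - 1) := by ring_nf
      _ ≤ Q ^ (p - 1) := Real.rpow_le_rpow hy0.le hy (by linarith)

/-- First variation of the energy. -/
lemma hasDerivAt_profileEnergy {p : ℝ} (hp : 1 < p) {G v z φ₁ φ₂ : ℝ → ℝ} (hG : ContDiff ℝ ∞ G)
    (hv : Continuous v) (hz : MemLp z (ENNReal.ofReal p) unitVol) (hφ₁ : Continuous φ₁)
    (hφ₂ : MemLp φ₂ (ENNReal.ofReal p) unitVol) :
    Integrable (fun x => p * (dualField p G v z x *
      (deriv (deriv G) (v x) * φ₁ x * z x + deriv G (v x) * φ₂ x))) unitVol ∧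
    HasDerivAt (fun t => profileEnergy p G (fun x => v x + t * φ₁ x) (fun x => z x + t * φ₂ x))
      (∫ x in Ioo (0 : ℝ) 1, p * (dualField p G v z x *
        (deriv (deriv G) (v x) * φ₁ x * z x + deriv G (v x) * φ₂ x))) 0 := by
  have hG1 := ContDiff.deriv_infty hG
  have hG2 := ContDiff.deriv_infty hG1
  obtain ⟨R₁, hR₁⟩ := isCompact_Icc.exists_bound_of_continuousOn (s := Icc (0 : ℝ) 1) hv.continuousOn
  obtain ⟨R₂, hR₂⟩ := isCompact_Icc.exists_bound_of_continuousOn (s := Icc (0 : ℝ) 1)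
    hφ₁.continuousOn
  have hR₁0 : 0 ≤ R₁ := (norm_nonneg _).trans (hR₁ 0 (by simp))
  have hR₂0 : 0 ≤ R₂ := (norm_nonneg _).trans (hR₂ 0 (by simp))
  obtain ⟨C₁, hC₁⟩ := isCompact_Icc.exists_bound_of_continuousOn (s := Icc (-(R₁ + R₂)) (R₁ + R₂))
    hG1.continuous.continuousOn
  obtain ⟨C₂, hC₂⟩ := isCompact_Icc.exists_bound_of_continuousOn (s := Icc (-(R₁ + R₂)) (R₁ + R₂))
    hG2.continuous.continuousOn
  have hC₁0 : 0 ≤ C₁ := (norm_nonneg _).trans (hC₁ 0 ⟨by linarith, by linarith⟩)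
  have hC₂0 : 0 ≤ C₂ := (norm_nonneg _).trans (hC₂ 0 ⟨by linarith, by linarith⟩)
  -- For `|t| < 1` the slopes stay in a fixed compact interval. There `C * q` dominates both `f` and
  -- its `t`-derivative, so `p (C q)^p` dominates the integrand and its derivative.
  set C : ℝ := C₁ + C₂ * R₂ with hC
  have hC0 : 0 ≤ C := by positivity
  set q : ℝ → ℝ := fun x => |z x| + |φ₂ x| with hq
  have hqL : MemLp q (ENNReal.ofReal p) unitVol := hz.abs.add hφ₂.abs
  have hqi : Integrable (fun x => p * (C ^ p * q x ^ p)) unitVol := by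
    have h := hqL.integrable_norm_rpow (by simp; linarith) ENNReal.ofReal_ne_top
    rw [ENNReal.toReal_ofReal (by linarith)] at h
    have h' : Integrable (fun x => q x ^ p) unitVol := by
      refine h.congr (ae_of_all _ fun x => ?_)
      simp only [Real.norm_eq_abs]
      rw [abs_of_nonneg (by positivity : 0 ≤ q x)]
    exact (h'.const_mul _).const_mul _
  have hzm := hz.1.aemeasurable
  have hφm := hφ₂.1.aemeasurable
  have hfm : ∀ t : ℝ, AEMeasurable (fun x => deriv G (v x + t * φ₁ x) * (z x + t * φ₂ x))
      unitVol := fun t =>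
    ((hG1.continuous.comp (hv.add (continuous_const.mul hφ₁))).measurable.aemeasurable).mul
      (hzm.add (hφm.const_mul t))
  have hin : ∀ x ∈ Ioo (0 : ℝ) 1, ∀ t ∈ Ioo (-1 : ℝ) 1,
      v x + t * φ₁ x ∈ Icc (-(R₁ + R₂)) (R₁ + R₂) := by
    intro x hx t ht
    have hx' := Ioo_subset_Icc_self hx
    have h1 : |v x| ≤ R₁ := hR₁ x hx'
    have h2 : |t * φ₁ x| ≤ R₂ := by
      rw [abs_mul]
      have := hR₂ x hx'
      rw [Real.norm_eq_abs] at this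
      nlinarith [abs_nonneg (φ₁ x), abs_lt.2 ht, abs_nonneg t]
    exact abs_le.1 ((abs_add_le _ _).trans (add_le_add h1 h2))
  have hzt : ∀ x, ∀ t ∈ Ioo (-1 : ℝ) 1, |z x + t * φ₂ x| ≤ q x := by
    intro x t ht
    refine (abs_add_le _ _).trans ?_
    rw [abs_mul]
    have := abs_lt.2 ht
    simp only [hq]
    nlinarith [abs_nonneg (φ₂ x)]
  have main := hasDerivAt_integral_of_dominated_loc_of_deriv_le (μ := unitVol) (x₀ := (0 : ℝ))
    (s := Ioo (-1 : ℝ) 1)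
    (F := fun t x => |deriv G (v x + t * φ₁ x) * (z x + t * φ₂ x)| ^ p)
    (F' := fun t x => p * (dualField p G (fun x => v x + t * φ₁ x) (fun x => z x + t * φ₂ x) x *
      (deriv (deriv G) (v x + t * φ₁ x) * φ₁ x * (z x + t * φ₂ x) +
        deriv G (v x + t * φ₁ x) * φ₂ x)))
    (bound := fun x => p * (C ^ p * q x ^ p))
    (Ioo_mem_nhds (by norm_num) (by norm_num)) ?_ ?_ ?_ ?_ hqi ?_
  · simp only [zero_mul, add_zero] at main
    exact main
  · exact .of_forall fun t => ((hfm t).abs.pow_const p).aestronglyMeasurable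
  · refine hqi.mono' ((hfm 0).abs.pow_const p).aestronglyMeasurable
      (ae_unit_iff.2 (ae_of_all _ fun x hx => ?_))
    have h1 := hC₁ _ (hin x hx 0 (by norm_num))
    have h2 := hzt x 0 (by norm_num)
    rw [Real.norm_eq_abs, abs_of_nonneg (by positivity),
      ← Real.mul_rpow hC0 (by positivity : 0 ≤ q x)]
    have h3 : |deriv G (v x + 0 * φ₁ x) * (z x + 0 * φ₂ x)| ≤ C * q x := by
      rw [abs_mul]
      exact mul_le_mul (h1.trans (by simp only [hC]; nlinarith)) h2 (abs_nonneg _) hC0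
    calc _ ≤ (C * q x) ^ p := Real.rpow_le_rpow (abs_nonneg _) h3 (by linarith)
      _ ≤ p * (C * q x) ^ p := le_mul_of_one_le_left (by positivity) hp.le
  · simp only [dualField]
    refine AEMeasurable.aestronglyMeasurable ?_
    have hvc : Continuous fun x => v x + 0 * φ₁ x := hv.add (continuous_const.mul hφ₁)
    exact ((((hfm 0).abs.pow_const _).mul (hfm 0)).mul
      ((((hG2.continuous.comp hvc).measurable.aemeasurable.mul hφ₁.measurable.aemeasurable).mul
        (hzm.add (hφm.const_mul 0))).add
        ((hG1.continuous.comp hvc).measurable.aemeasurable.mul hφm))).const_mul p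
  · refine ae_unit_iff.2 (ae_of_all _ fun x hx t ht => ?_)
    have h1 := hC₁ _ (hin x hx t ht)
    have h2 := hC₂ _ (hin x hx t ht)
    have h3 := hzt x t ht
    have h4 := hR₂ x (Ioo_subset_Icc_self hx)
    rw [Real.norm_eq_abs] at h1 h2 h4
    have hq0 : 0 ≤ q x := by positivity
    have hφq : |φ₂ x| ≤ q x := by simp only [hq]; linarith [abs_nonneg (z x)]
    have h5 : |deriv G (v x + t * φ₁ x) * (z x + t * φ₂ x)| ≤ C * q x := by
      rw [abs_mul]
      exact mul_le_mul (h1.trans (by simp only [hC]; nlinarith)) h3 (abs_nonneg _) hC0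
    have h6 : |deriv (deriv G) (v x + t * φ₁ x) * φ₁ x * (z x + t * φ₂ x) +
        deriv G (v x + t * φ₁ x) * φ₂ x| ≤ C * q x := by
      refine (abs_add_le _ _).trans ?_
      rw [abs_mul, abs_mul, abs_mul]
      have h7 : |deriv (deriv G) (v x + t * φ₁ x)| * |φ₁ x| * |z x + t * φ₂ x| ≤ C₂ * R₂ * q x :=
        mul_le_mul (mul_le_mul h2 h4 (abs_nonneg _) hC₂0) h3 (abs_nonneg _) (by positivity)
      have h8 : |deriv G (v x + t * φ₁ x)| * |φ₂ x| ≤ C₁ * q x :=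
        mul_le_mul h1 hφq (abs_nonneg _) hC₁0
      simp only [hC]
      linarith
    rw [Real.norm_eq_abs, abs_mul, abs_mul, abs_of_nonneg (by linarith : 0 ≤ p)]
    refine mul_le_mul_of_nonneg_left ?_ (by linarith)
    refine (mul_le_mul (abs_rpow_sub_two_mul_le hp h5) h6 (abs_nonneg _)
      (by positivity)).trans ?_
    rw [← Real.mul_rpow hC0 hq0]
    rcases (mul_nonneg hC0 hq0).eq_or_lt with h0 | h0
    · rw [← h0, mul_zero, Real.zero_rpow (by linarith)]
    · rw [← Real.rpow_add_one h0.ne']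
      ring_nf
      exact le_rfl
  · refine ae_of_all _ fun x t _ => ?_
    have hvt : HasDerivAt (fun t => v x + t * φ₁ x) (φ₁ x) t := by
      simpa using ((hasDerivAt_id t).mul_const (φ₁ x)).const_add (v x)
    have hzt : HasDerivAt (fun t => z x + t * φ₂ x) (φ₂ x) t := by
      simpa using ((hasDerivAt_id t).mul_const (φ₂ x)).const_add (z x)
    have hg : HasDerivAt (fun t => deriv G (v x + t * φ₁ x))
        (deriv (deriv G) (v x + t * φ₁ x) * φ₁ x) t := by
      have hg0 := (hG1.differentiable (by simp) (v x + t * φ₁ x)).hasDerivAt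
      exact hg0.comp t hvt
    have := (hasDerivAt_abs_rpow (deriv G (v x + t * φ₁ x) * (z x + t * φ₂ x)) hp).comp t
      (hg.mul hzt)
    convert! this using 1
    simp only [dualField]
    ring

/-- In the first variation `φ₁` and `φ₂` are independent; `φ₁ = 0` and `φ₂ = 1 / G'(v)` leave
exactly `p` times the dual field. -/
lemma integrable_dualField {p : ℝ} (hp : 1 < p) {G v z : ℝ → ℝ} (hG : ContDiff ℝ ∞ G)
    (hpos : ∀ s, 0 < deriv G s)
    (hv : Continuous v) (hz : MemLp z (ENNReal.ofReal p) unitVol) :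
    Integrable (dualField p G v z) unitVol := by
  have hk : Continuous fun x => (deriv G (v x))⁻¹ :=
    ((ContDiff.deriv_infty hG).continuous.comp hv).inv₀ fun x => (hpos _).ne'
  have h := (hasDerivAt_profileEnergy hp hG hv hz (φ₁ := fun _ => 0) continuous_const
    (memLp_of_continuous hk _)).1.const_mul p⁻¹
  refine h.congr (ae_of_all _ fun x => ?_)
  have := (hpos (v x)).ne'
  have : p ≠ 0 := by linarith
  field_simp
  ring

/-- Only `t > 0` need be admissible, so minimality gives a sign for the right difference quotient,
not a vanishing derivative. -/
lemma IsProfileMinimizer.variation_nonneg {p : ℝ} (hp : 1 < p) {G ψ u v z φ φ₁ φ₂ : ℝ → ℝ}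
    (hG : ContDiff ℝ ∞ G) (h : IsProfileMinimizer p G ψ u v z) (hφ : IsPrim φ φ₁)
    (hφ₁ : IsPrim φ₁ φ₂) (hφ₂ : MemLp φ₂ (ENNReal.ofReal p) unitVol) (h0 : φ 0 = 0)
    (h1 : φ 1 = 0) {ε : ℝ} (hε : 0 < ε)
    (hψ : ∀ t ∈ Ioo 0 ε, ∀ x ∈ Icc (0 : ℝ) 1, ψ x ≤ u x + t * φ x) :
    0 ≤ ∫ x in Ioo (0 : ℝ) 1, dualField p G v z x *
      (deriv (deriv G) (v x) * φ₁ x * z x + deriv G (v x) * φ₂ x) := by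
  have hd := (hasDerivAt_profileEnergy hp hG h.1.prim_v.continuous h.1.memLp hφ₁.continuous
    hφ₂).2
  have hs := (hasDerivWithinAt_iff_tendsto_slope' (s := Ioi (0 : ℝ)) (by simp)).1
    hd.hasDerivWithinAt
  have hge : ∀ᶠ t in 𝓝[>] (0 : ℝ), 0 ≤ slope (fun t => profileEnergy p G
      (fun x => v x + t * φ₁ x) (fun x => z x + t * φ₂ x)) 0 t := by
    filter_upwards [Ioo_mem_nhdsGT hε] with t ht
    rw [slope_def_field]
    refine div_nonneg ?_ (by linarith [ht.1])
    have hprof : IsProfile p ψ (fun x => u x + t * φ x) (fun x => v x + t * φ₁ x)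
        (fun x => z x + t * φ₂ x) :=
      ⟨h.1.prim_u.add (hφ.const_mul t), h.1.prim_v.add (hφ₁.const_mul t),
        h.1.memLp.add (hφ₂.const_mul t), by simp [h.1.left, h0], by simp [h.1.right, h1],
        hψ t ht⟩
    have := h.2 _ _ _ hprof
    simpa using this
  have := ge_of_tendsto hs hge
  rw [integral_const_mul] at this
  exact nonneg_of_mul_nonneg_right this (by linarith)

/-- First variation along `φ` with `φ' = η / G'(v)` and `η' = ζ`. -/
lemma IsProfileMinimizer.dualField_nonneg {p : ℝ} (hp : 1 < p) {G ψ u v z η ζ : ℝ → ℝ}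
    (hG : ContDiff ℝ ∞ G) (hpos : ∀ s, 0 < deriv G s) (h : IsProfileMinimizer p G ψ u v z)
    (hη : IsPrim η ζ) {C : ℝ} (hζ : ∀ x, |ζ x| ≤ C)
    (h1 : prim 0 (fun x => (deriv G (v x))⁻¹ * η x) 1 = 0) {ε : ℝ} (hε : 0 < ε)
    (hψ : ∀ t ∈ Ioo 0 ε, ∀ x ∈ Icc (0 : ℝ) 1,
      ψ x ≤ u x + t * prim 0 (fun x => (deriv G (v x))⁻¹ * η x) x) :
    0 ≤ ∫ x in Ioo (0 : ℝ) 1, dualField p G v z x * ζ x := by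
  have hG1 := ContDiff.deriv_infty hG
  have hG2 := ContDiff.deriv_infty hG1
  have hvc := h.1.prim_v.continuous
  have hS : ContDiff ℝ 1 fun s => (deriv G s)⁻¹ :=
    (hG1.of_le (by exact_mod_cast le_top)).inv fun s => (hpos s).ne'
  have hSd : ∀ s, deriv (fun s => (deriv G s)⁻¹) s = -deriv (deriv G) s / deriv G s ^ 2 :=
    fun s => ((hG1.differentiable (by simp) s).hasDerivAt.inv (hpos s).ne').deriv
  have hφ₁ := (IsPrim.comp hS h.1.prim_v).mul hη
  have hφ := isPrim_prim_of_continuous 0 hφ₁.continuous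
  have hSc : Continuous fun x => deriv (fun s => (deriv G s)⁻¹) (v x) * η x := by
    refine Continuous.mul ?_ hη.continuous
    exact (hS.continuous_deriv le_rfl).comp hvc
  have hkc : Continuous fun x => (deriv G (v x))⁻¹ := hS.continuous.comp hvc
  have hζm : AEStronglyMeasurable ζ unitVol := hη.integrableOn.aestronglyMeasurable
  have hL : MemLp (fun x => deriv (fun s => (deriv G s)⁻¹) (v x) * z x * η x +
      (deriv G (v x))⁻¹ * ζ x) (ENNReal.ofReal p) unitVol := by
    refine MemLp.add ?_ ?_
    · have := h.1.memLp.mul' (memLp_of_continuous hSc ⊤) (r := ENNReal.ofReal p)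
      refine this.ae_eq (ae_of_all _ fun x => ?_)
      simp only
      ring
    · have hζL : MemLp ζ (ENNReal.ofReal p) unitVol := MemLp.of_bound hζm C (ae_of_all _ hζ)
      exact hζL.mul' (memLp_of_continuous hkc ⊤)
  have key := h.variation_nonneg hp hG hφ hφ₁ hL (prim_zero _ _) h1 hε hψ
  -- For `φ₁ = η / G'(v)` the terms with `G''` cancel: `G''(v) φ₁ z + G'(v) φ₂ = (G'(v) φ₁)' = ζ`.
  refine key.trans_eq (integral_congr_ae (ae_of_all _ fun x => ?_))
  simp only [hSd]
  have := (hpos (v x)).ne'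
  field_simp
  ring

/-! ### Concavity of minimizers -/

lemma IsPrim.le_of_ae_nonneg {f g : ℝ → ℝ} {a b : ℝ} (h : IsPrim f g) (hab : a ≤ b)
    (hg : ∀ᵐ x, x ∈ Ioo a b → 0 ≤ g x) : f a ≤ f b := by
  have : 0 ≤ ∫ t in a..b, g t := by
    refine intervalIntegral.integral_nonneg_of_ae_restrict hab ?_
    rw [← restrict_Ioo_eq_restrict_Icc]
    exact (ae_restrict_iff' measurableSet_Ioo).2 hg
  rw [h.integral_eq] at this
  linarith

lemma IsPrim.neg {f g : ℝ → ℝ} (h : IsPrim f g) : IsPrim (fun x => -f x) (fun x => -g x) := by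
  simpa using h.const_mul (-1)

/-- Slopes of minimizers decrease. -/
lemma IsProfileMinimizer.antitoneOn {p : ℝ} (hp : 1 < p) {G ψ u v z : ℝ → ℝ}
    (hG : ContDiff ℝ ∞ G) (hpos : ∀ s, 0 < deriv G s) (h : IsProfileMinimizer p G ψ u v z) :
    AntitoneOn v (Icc 0 1) := by
  set k : ℝ → ℝ := fun x => (deriv G (v x))⁻¹ with hk
  have hkc : Continuous k :=
    ((ContDiff.deriv_infty hG).continuous.comp h.1.prim_v.continuous).inv₀ fun x => (hpos _).ne'
  have hkpos : ∀ x, 0 < k x := fun x => inv_pos.2 (hpos _)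
  -- Negative exactly where `z > 0`; the truncation at `1` provides the bound on `ζ` that
  -- `dualField_nonneg` needs.
  set ζ : ℝ → ℝ := fun x => -max (min (z x) 1) 0 with hζ
  have hζ0 : ∀ x, ζ x ≤ 0 := fun x => neg_nonpos.2 (le_max_right _ _)
  have hζ1 : ∀ x, |ζ x| ≤ 1 := fun x => by
    rw [hζ, abs_neg, abs_of_nonneg (le_max_right _ _)]
    exact max_le (min_le_right _ _) zero_le_one
  have hζi : ∀ a b, IntervalIntegrable ζ volume a b := fun a b => by
    have hz := h.1.prim_v.1 a b
    refine hz.mono_fun ?_ (ae_of_all _ fun x => ?_)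
    · exact ((hz.aestronglyMeasurable_restrict_uIoc.inf
        aestronglyMeasurable_const).sup aestronglyMeasurable_const).neg
    · simp only [hζ, Real.norm_eq_abs, abs_neg]
      rw [abs_of_nonneg (le_max_right _ _)]
      exact max_le ((min_le_left _ _).trans (le_abs_self _)) (abs_nonneg _)
  have hI : 0 < ∫ x in (0 : ℝ)..1, k x :=
    intervalIntegral.intervalIntegral_pos_of_pos (hkc.intervalIntegrable _ _) hkpos one_pos
  have hη₁ := isPrim_prim 0 hζi
  -- The value of `η` at `0` that makes `φ(1) = ∫ k η` vanish.
  set c : ℝ := -(∫ x in (0 : ℝ)..1, k x * prim 0 ζ x) / ∫ x in (0 : ℝ)..1, k x with hc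
  have hη := isPrim_prim c hζi
  have hηanti : ∀ x y, x ≤ y → prim c ζ y ≤ prim c ζ x := fun x y hxy => by
    have := hη.neg.le_of_ae_nonneg hxy (ae_of_all _ fun t _ => neg_nonneg.2 (hζ0 t))
    linarith
  have hkη : Continuous fun x => k x * prim c ζ x := hkc.mul hη.continuous
  have hφ := isPrim_prim_of_continuous 0 hkη
  have hkη₁ : Continuous fun x => k x * prim 0 ζ x := hkc.mul hη₁.continuous
  have hφ1 : prim 0 (fun x => k x * prim c ζ x) 1 = 0 := by
    simp only [prim, zero_add]
    have : ∀ x, k x * (c + ∫ t in (0 : ℝ)..x, ζ t) = c * k x + k x * prim 0 ζ x := fun x => by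
      simp only [prim]; ring
    simp_rw [this]
    rw [intervalIntegral.integral_add ((hkc.intervalIntegrable _ _).const_mul c)
      (hkη₁.intervalIntegrable _ _), intervalIntegral.integral_const_mul, hc]
    field_simp
    ring
  -- As `η` decreases, `φ' = k η` changes sign at most once, from plus to minus. With zero end
  -- values this gives `φ ≥ 0`.
  have hφnn : ∀ x ∈ Icc (0 : ℝ) 1, 0 ≤ prim 0 (fun x => k x * prim c ζ x) x := by
    intro x hx
    rcases le_total 0 (prim c ζ x) with hx0 | hx0
    · have := hφ.le_of_ae_nonneg hx.1 (ae_of_all _ fun t ht =>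
        mul_nonneg (hkpos t).le (hx0.trans (hηanti t x ht.2.le)))
      rwa [prim_zero] at this
    · have := hφ.neg.le_of_ae_nonneg hx.2 (ae_of_all _ fun t ht =>
        neg_nonneg.2 (mul_nonpos_of_nonneg_of_nonpos (hkpos t).le
          ((hηanti x t ht.1.le).trans hx0)))
      linarith
  have key := h.dualField_nonneg hp hG hpos hη hζ1 hφ1 one_pos fun t ht x hx =>
    (h.1.le x hx).trans (le_add_of_nonneg_right (mul_nonneg ht.1.le (hφnn x hx)))
  have hmi := integrable_dualField hp hG hpos h.1.prim_v.continuous h.1.memLp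
  have hint : Integrable (fun x => dualField p G v z x * ζ x) unitVol :=
    hmi.mul_bdd hη.integrableOn.aestronglyMeasurable (ae_of_all _ hζ1)
  have hle : ∀ x, dualField p G v z x * ζ x ≤ 0 := by
    intro x
    rcases le_total (z x) 0 with hz | hz
    · have : ζ x = 0 := by
        simp only [hζ, neg_eq_zero]
        exact max_eq_right ((min_le_left _ _).trans hz)
      rw [this, mul_zero]
    · exact mul_nonpos_of_nonneg_of_nonpos (mul_nonneg (Real.rpow_nonneg (abs_nonneg _) _)
        (mul_nonneg (hpos _).le hz)) (hζ0 x)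
  -- The integrand is nonpositive and its integral nonnegative, so it vanishes a.e., which excludes
  -- `z > 0`.
  have hz0 : (fun x => -(dualField p G v z x * ζ x)) =ᵐ[unitVol] 0 := by
    refine (integral_eq_zero_iff_of_nonneg (fun x => neg_nonneg.2 (hle x)) hint.neg).1 ?_
    rw [integral_neg]
    have := integral_nonpos (μ := unitVol) hle
    linarith
  have hz : ∀ᵐ x, x ∈ Ioo (0 : ℝ) 1 → 0 ≤ -z x := by
    refine ae_unit_iff.1 ?_
    filter_upwards [hz0] with x hx
    by_contra! hcon
    have hzx : 0 < z x := by linarith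
    have hf : 0 < deriv G (v x) * z x := mul_pos (hpos _) hzx
    have h1 : 0 < dualField p G v z x := mul_pos (Real.rpow_pos_of_pos (abs_pos.2 hf.ne') _) hf
    have h2 : ζ x < 0 := by
      simp only [hζ, neg_lt_zero]
      exact lt_max_of_lt_left (lt_min hzx one_pos)
    have h3 := mul_neg_of_pos_of_neg h1 h2
    simp at hx
    rcases hx with hx | hx
    · exact h1.ne' hx
    · exact h2.ne hx
  intro x hx y hy hxy
  have := h.1.prim_v.neg.le_of_ae_nonneg hxy (hz.mono fun t ht ht' =>
    ht ⟨hx.1.trans_lt ht'.1, ht'.2.trans_le hy.2⟩)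
  linarith

/-! ### The Euler-Lagrange equation off the contact set -/

/-- Euler-Lagrange equation on an interval `(0, X)` on which the obstacle is not touched. -/
lemma IsProfileMinimizer.euler_lagrange {p : ℝ} (hp : 1 < p) {G ψ u v z : ℝ → ℝ}
    (hG : ContDiff ℝ ∞ G) (hpos : ∀ s, 0 < deriv G s) (h : IsProfileMinimizer p G ψ u v z)
    (hψ : ContinuousOn ψ (Icc 0 1)) {X : ℝ} (hX : 0 < X) (hX1 : X ≤ 1)
    (hlt : ∀ x ∈ Ico 0 X, ψ x < u x) :
    ∃ c : ℝ, ∀ᵐ x, x ∈ Ioo 0 X →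
      dualField p G v z x = c * prim 0 (fun y => (deriv G (v y))⁻¹) x := by
  set k : ℝ → ℝ := fun x => (deriv G (v x))⁻¹ with hk
  have hkc : Continuous k :=
    ((ContDiff.deriv_infty hG).continuous.comp h.1.prim_v.continuous).inv₀ fun x => (hpos _).ne'
  have hkpos : ∀ x, 0 < k x := fun x => inv_pos.2 (hpos _)
  have hK := isPrim_prim_of_continuous 0 hkc
  have hmi := integrable_dualField hp hG hpos h.1.prim_v.continuous h.1.memLp
  have hml : LocallyIntegrableOn (dualField p G v z) (Ioo 0 X) :=
    (IntegrableOn.mono_set hmi (Ioo_subset_Ioo le_rfl hX1)).locallyIntegrableOn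
  refine ae_eq_const_mul_of_orthogonal le_rfl hX hX1 hK.continuous (fun x hx => ?_) hml ?_
  · simp only [prim, zero_add]
    exact intervalIntegral.intervalIntegral_pos_of_pos (hkc.intervalIntegrable _ _) hkpos hx.1
  -- The inequality for `ζ` and for `-ζ` gives equality. Orthogonality to `K` is the only
  -- constraint, since `η(0)` is free.
  have main : ∀ ζ, IsTestFun ζ → tsupport ζ ⊆ Ioo 0 X →
      ∫ x in Ioo (0 : ℝ) 1, ζ x * prim 0 k x = 0 →
      0 ≤ ∫ x in Ioo (0 : ℝ) 1, dualField p G v z x * ζ x := by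
    intro ζ hζ hζs hζK
    obtain ⟨b, hb0, hbX, hzero⟩ : ∃ b, 0 ≤ b ∧ b < X ∧ ∀ x, b ≤ x → ζ x = 0 := by
      rcases (tsupport ζ).eq_empty_or_nonempty with he | hne
      · exact ⟨0, le_rfl, hX, fun x _ => image_eq_zero_of_notMem_tsupport (by simp [he])⟩
      · have hcp : IsCompact (tsupport ζ) := hζ.compact
        have hm := hζs (hcp.sSup_mem hne)
        refine ⟨(sSup (tsupport ζ) + X) / 2, by linarith [hm.1, hm.2], by linarith [hm.2],
          fun x hx => image_eq_zero_of_notMem_tsupport fun hx' => ?_⟩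
        have := le_csSup hcp.bddAbove hx'
        linarith [hm.2]
    have hζc := hζ.smooth.continuous
    obtain ⟨Z, hZ⟩ := hζ.smooth.continuous.bounded_above_of_compact_support hζ.compact
    -- This makes `η`, and later `φ`, vanish on `[b, 1]`, where the obstacle may be touched.
    set c : ℝ := -∫ x in (0 : ℝ)..1, ζ x with hc
    have hη := isPrim_prim_of_continuous c hζc
    have hη1 : prim c ζ 1 = 0 := by simp [prim, hc]
    have hηb : ∀ x, b ≤ x → prim c ζ x = 0 := by
      intro x hx
      have e : ∫ t in x..1, ζ t = 0 := by
        refine intervalIntegral.integral_zero_ae (ae_of_all _ fun y hy => hzero y ?_)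
        have := hy.1
        exact (le_min hx (hbX.le.trans hX1)).trans this.le
      rw [hη.integral_eq, hη1] at e
      linarith
    have hkη : Continuous fun x => k x * prim c ζ x := hkc.mul hη.continuous
    have hφ := isPrim_prim_of_continuous 0 hkη
    -- Integration by parts: `φ(1) = ∫ K' η = -∫ K ζ = 0`.
    have hφ1 : prim 0 (fun x => k x * prim c ζ x) 1 = 0 := by
      have hKζ : Continuous fun x => prim 0 k x * ζ x := hK.continuous.mul hζc
      have e := (hK.mul hη).integral_eq 0 1
      rw [hη1, prim_zero, intervalIntegral.integral_add
        (hkη.intervalIntegrable _ _) (hKζ.intervalIntegrable _ _)] at e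
      rw [setIntegral_unit] at hζK
      simp_rw [mul_comm (ζ _)] at hζK
      rw [hζK] at e
      rw [prim]
      linarith
    have hφb : ∀ x ∈ Icc b 1, prim 0 (fun x => k x * prim c ζ x) x = 0 := by
      intro x hx
      have e : ∫ t in x..1, k t * prim c ζ t = 0 := by
        refine intervalIntegral.integral_zero_ae (ae_of_all _ fun y hy => ?_)
        rw [uIoc_of_le hx.2] at hy
        rw [hηb y (hx.1.trans hy.1.le), mul_zero]
      rw [hφ.integral_eq, hφ1] at e
      linarith
    obtain ⟨M, hM⟩ := isCompact_Icc.exists_bound_of_continuousOn (s := Icc (0 : ℝ) 1)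
      hφ.continuous.continuousOn
    have hM0 : 0 ≤ M := (norm_nonneg _).trans (hM 0 (by simp))
    obtain ⟨x₁, hx₁, hmin⟩ := isCompact_Icc.exists_isMinOn (nonempty_Icc.2 hb0)
      (h.1.prim_u.continuous.continuousOn.sub (hψ.mono (Icc_subset_Icc le_rfl (hbX.le.trans hX1))))
    set δ := u x₁ - ψ x₁ with hδ
    have hδ0 : 0 < δ := sub_pos.2 (hlt x₁ ⟨hx₁.1, hx₁.2.trans_lt hbX⟩)
    -- On `[0, b]` the gap to the obstacle is at least `δ` while `|φ| ≤ M`; the `+ 1` avoids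
    -- division by zero.
    refine h.dualField_nonneg hp hG hpos hη hZ hφ1 (ε := δ / (M + 1)) (by positivity)
      fun t ht x hx => ?_
    rcases le_total b x with hbx | hbx
    · have := hφb x ⟨hbx, hx.2⟩
      simp only [hk] at this
      rw [this, mul_zero, add_zero]
      exact h.1.le x hx
    · have h1 : δ ≤ u x - ψ x := hmin ⟨hx.1, hbx⟩
      have h2 := (abs_le.1 (hM x hx)).1
      simp only [hk] at h2
      have h3 : t * (M + 1) < δ := (lt_div_iff₀ (by positivity)).1 ht.2
      have h4 := mul_le_mul_of_nonneg_left h2 ht.1.le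
      nlinarith [ht.1]
  intro ζ hζ hζs hζK
  have h1 := main ζ hζ hζs hζK
  have hneg : IsTestFun (fun x => -ζ x) :=
    ⟨hζ.smooth.neg, hζ.compact.neg, (tsupport_neg ζ).subset.trans hζ.supp⟩
  have h2 := main _ hneg ((tsupport_neg ζ).subset.trans hζs) (by
    simp only [neg_mul]
    rw [integral_neg, hζK, neg_zero])
  simp only [mul_neg] at h2
  rw [integral_neg] at h2
  simp_rw [mul_comm (ζ _)]
  linarith

/-! ### Explicit integration and the height formula -/

/-- A profile solving the Euler-Lagrange equation up to a point `X` where its slope vanishes: its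
height at `X` is `X * H(A)`, where `A` is the initial slope. -/
lemma height_eq_mul_ratioH {p : ℝ} (hp : 1 < p) {G u v z : ℝ → ℝ} (hG : ContDiff ℝ ∞ G)
    (hpos : ∀ s, 0 < deriv G s) (hu : IsPrim u v) (hv : IsPrim v z) (hu0 : u 0 = 0) {X : ℝ}
    (hX : 0 < X) (hvX : v X = 0) (huX : 0 < u X) {c : ℝ}
    (hEL : ∀ᵐ x, x ∈ Ioo 0 X →
      dualField p G v z x = c * prim 0 (fun y => (deriv G (v y))⁻¹) x) :
    0 < v 0 ∧ u X = X * ratioH p G (v 0) := by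
  set k : ℝ → ℝ := fun x => (deriv G (v x))⁻¹ with hk
  have hkc : Continuous k :=
    ((ContDiff.deriv_infty hG).continuous.comp hv.continuous).inv₀ fun x => (hpos _).ne'
  have hkpos : ∀ x, 0 < k x := fun x => inv_pos.2 (hpos _)
  set K := prim 0 k with hKdef
  have hK : IsPrim K k := isPrim_prim_of_continuous 0 hkc
  have hK0 : K 0 = 0 := prim_zero _ _
  have hKd : ∀ x, HasDerivAt K (k x) x := hK.hasDerivAt hkc
  have hKmono : StrictMono K := strictMono_of_hasDerivAt_pos hKd hkpos
  have hKpos : ∀ x, 0 < x → 0 < K x := fun x hx => hK0 ▸ hKmono hx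
  have hp1 : 0 < p - 1 := by linarith
  -- Otherwise `z ≥ 0` a.e. on `(0, X)`, hence `v ≤ v X = 0` there and `u X ≤ u 0 = 0`.
  have hc : c < 0 := by
    by_contra! hc
    have hz : ∀ᵐ x, x ∈ Ioo 0 X → 0 ≤ z x := by
      filter_upwards [hEL] with x hx hxX
      by_contra! hzx
      have h1 := hx hxX
      have hf : deriv G (v x) * z x < 0 := mul_neg_of_pos_of_neg (hpos _) hzx
      have h2 : dualField p G v z x < 0 :=
        mul_neg_of_pos_of_neg (Real.rpow_pos_of_pos (abs_pos.2 hf.ne) _) hf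
      have h3 := mul_nonneg hc (hKpos x hxX.1).le
      linarith
    have hvle : ∀ x ∈ Ioo 0 X, v x ≤ 0 := fun x hx => by
      have := hv.le_of_ae_nonneg hx.2.le (hz.mono fun t ht ht' =>
        ht ⟨hx.1.trans ht'.1, ht'.2⟩)
      rwa [hvX] at this
    have := hu.neg.le_of_ae_nonneg hX.le
      (ae_of_all _ fun t ht => neg_nonneg.2 (hvle t ht))
    linarith
  -- The exponent inverting `y ↦ y^(p-1)`: the equation becomes `G'(v) z = -a K^r`.
  set r : ℝ := 1 / (p - 1) with hr
  have hr0 : 0 < r := by positivity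
  have hrp : (r + 1) * (1 / p) = r := by
    rw [hr]; field_simp; ring
  set a : ℝ := (-c) ^ r with ha
  have ha0 : 0 < a := Real.rpow_pos_of_pos (by linarith) _
  have hz : ∀ᵐ x, x ∈ Ioo 0 X → z x = -(a * K x ^ r * k x) := by
    filter_upwards [hEL] with x hx hxX
    have h1 := hx hxX
    have hKx := hKpos x hxX.1
    have hneg : c * K x < 0 := mul_neg_of_neg_of_pos hc hKx
    set f := deriv G (v x) * z x with hf
    have hd : dualField p G v z x = |f| ^ (p - 2) * f := rfl
    have hf0 : f < 0 := by
      by_contra! hf0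
      have := mul_nonneg (Real.rpow_nonneg (abs_nonneg f) (p - 2)) hf0
      linarith
    have habs : |f| = -f := abs_of_neg hf0
    have h2 : (-f) ^ (p - 1) = -c * K x := by
      rw [hd, habs] at h1
      have : (-f) ^ (p - 1) = (-f) ^ (p - 2) * (-f) := by
        rw [← Real.rpow_add_one (by linarith : -f ≠ 0)]
        ring_nf
      rw [this]
      linarith
    have h3 : -f = a * K x ^ r := by
      rw [ha, ← Real.mul_rpow (by linarith) hKx.le, ← h2, ← Real.rpow_mul (by linarith), hr,
        mul_one_div_cancel hp1.ne', Real.rpow_one]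
    have h4 : z x = f * k x := by
      have := (hpos (v x)).ne'
      rw [hf, hk]
      field_simp
    rw [h4]
    linear_combination (-k x) * h3
  -- A primitive of `a K^r K' = -z`, so that `v = v 0 - L` on `[0, X]`.
  set L : ℝ → ℝ := fun x => a / (r + 1) * K x ^ (r + 1) with hL
  have hLd : ∀ x, HasDerivAt L (a * K x ^ r * k x) x := fun x => by
    have h1 := (Real.hasDerivAt_rpow_const (x := K x) (p := r + 1)
      (Or.inr (by linarith))).comp x (hKd x)
    have h2 := h1.const_mul (a / (r + 1))
    convert! h2 using 1
    rw [add_sub_cancel_right]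
    field_simp
  have hL0 : L 0 = 0 := by
    simp only [hL, hK0]
    rw [Real.zero_rpow (by linarith), mul_zero]
  have hLc : Continuous fun x => a * K x ^ r * k x :=
    (continuous_const.mul (hK.continuous.rpow_const fun _ => Or.inr hr0.le)).mul hkc
  have hvL : ∀ x ∈ Icc 0 X, v x = v 0 - L x := by
    intro x hx
    have h1 : ∫ t in (0 : ℝ)..x, z t = ∫ t in (0 : ℝ)..x, -(a * K t ^ r * k t) := by
      refine intervalIntegral.integral_congr_ae ?_
      have hne : ∀ᵐ t : ℝ, t ≠ X := by simp [ae_iff]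
      filter_upwards [hz, hne] with t ht htX ht'
      rw [uIoc_of_le hx.1] at ht'
      exact ht ⟨ht'.1, lt_of_le_of_ne (ht'.2.trans hx.2) htX⟩
    rw [intervalIntegral.integral_neg, intervalIntegral.integral_eq_sub_of_hasDerivAt
      (fun t _ => hLd t) (hLc.intervalIntegrable _ _), hv.integral_eq, hL0] at h1
    linarith
  have hLmono : StrictMonoOn L (Ici 0) := by
    intro x hx y hy hxy
    have hKx : 0 ≤ K x := hK0 ▸ hKmono.monotone hx
    have := Real.rpow_lt_rpow hKx (hKmono hxy) (by linarith : 0 < r + 1)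
    exact mul_lt_mul_of_pos_left this (by positivity)
  have hLX : L X = v 0 := by
    have := hvL X ⟨hX.le, le_rfl⟩
    linarith
  have hA : 0 < v 0 := by
    rw [← hLX, ← hL0]
    exact hLmono (by simp) hX.le hX
  refine ⟨hA, ?_⟩
  set w : ℝ → ℝ := fun x => v 0 - L x with hw
  have hwc : ContinuousOn w (Icc 0 X) := fun x _ =>
    ((hLd x).const_sub (v 0)).continuousAt.continuousWithinAt
  have hanti : StrictAntiOn w (Icc 0 X) := fun x hx y hy hxy => by
    have := hLmono hx.1 hy.1 hxy
    simp only [hw]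
    linarith
  have himage : w '' Ioo 0 X = Ioo 0 (v 0) := by
    have hw0 : w 0 = v 0 := by simp [hw, hL0]
    have hwX : w X = 0 := by simp [hw, hLX]
    refine Subset.antisymm ?_ ?_
    · rintro _ ⟨x, hx, rfl⟩
      constructor
      · rw [← hwX]
        exact hanti ⟨hx.1.le, hx.2.le⟩ ⟨hX.le, le_rfl⟩ hx.2
      · rw [← hw0]
        exact hanti ⟨le_rfl, hX.le⟩ ⟨hx.1.le, hx.2.le⟩ hx.1
    · have := intermediate_value_Ioo' hX.le hwc
      rwa [hw0, hwX] at this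
  -- Because `(r + 1) / p = r`, the weight is `L^(1/p) = D K^r`. Under `s = v x` it cancels the
  -- factor `K^r` of the Jacobian `a K^r k`, while `G'(v)` cancels `k`.
  set D : ℝ := (a / (r + 1)) ^ (1 / p) with hD
  have hD0 : 0 < D := Real.rpow_pos_of_pos (by positivity) _
  have hcov : ∀ g : ℝ → ℝ, ∫ s in (0 : ℝ)..v 0, g s * (deriv G s / (v 0 - s) ^ (1 / p)) =
      a / D * ∫ x in (0 : ℝ)..X, g (v x) := by
    intro g
    rw [intervalIntegral.integral_of_le hA.le, integral_Ioc_eq_integral_Ioo, ← himage,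
      integral_image_eq_integral_abs_deriv_smul measurableSet_Ioo
        (fun x _ => ((hLd x).const_sub (v 0)).hasDerivWithinAt)
        (hanti.injOn.mono Ioo_subset_Icc_self),
      intervalIntegral.integral_of_le hX.le, integral_Ioc_eq_integral_Ioo, ← integral_const_mul]
    refine setIntegral_congr_fun measurableSet_Ioo fun x hx => ?_
    have hKx := hKpos x hx.1
    have hKr : 0 < K x ^ r := Real.rpow_pos_of_pos hKx _
    have hLp : L x ^ (1 / p) = D * K x ^ r := by
      simp only [hL]
      rw [Real.mul_rpow (by positivity) (Real.rpow_nonneg hKx.le _), ← Real.rpow_mul hKx.le, hrp]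
    have hGk : deriv G (v x) ≠ 0 := (hpos _).ne'
    have hwx : v 0 - L x = v x := (hvL x ⟨hx.1.le, hx.2.le⟩).symm
    simp only [smul_eq_mul]
    rw [abs_neg, abs_of_pos (by have := hkpos x; positivity), sub_sub_cancel, hLp, hwx]
    simp only [hk]
    field_simp
  -- `g = id` gives the numerator of `H`, through `∫ v = u X`; `g = 1` gives the denominator,
  -- through `∫ 1 = X`.
  have hnum := hcov id
  have hden := hcov fun _ => 1
  simp only [id, one_mul, ← mul_div_assoc] at hnum hden
  rw [hu.integral_eq, hu0, sub_zero] at hnum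
  simp only [intervalIntegral.integral_const, sub_zero, smul_eq_mul, mul_one] at hden
  rw [ratioH, hnum, hden]
  field_simp

/-! ### Cone obstacles, reflection and the final bound -/

lemma IsProfile.hasDerivAt {p : ℝ} {ψ u v z : ℝ → ℝ} (h : IsProfile p ψ u v z) (x : ℝ) :
    HasDerivAt u (v x) x := h.prim_u.hasDerivAt h.prim_v.continuous x

/-- A concave profile does not touch a symmetric cone in `[0, 1/2)`. -/
lemma lt_profile_of_antitoneOn {p : ℝ} {ψ u v z : ℝ → ℝ} (hψ : IsSymmCone ψ)
    (h : IsProfile p ψ u v z) (hv : AntitoneOn v (Icc 0 1)) {X : ℝ} (hX : X ≤ 1 / 2) :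
    ∀ x ∈ Ico 0 X, ψ x < u x := by
  intro x hx
  obtain ⟨a, b, hab⟩ := hψ.affine_left
  have hb : b < 0 := by
    have := hab 0 (by norm_num)
    have := hψ.neg_left
    linarith
  refine lt_of_le_of_ne (h.le x ⟨hx.1, by linarith [hx.2]⟩) fun heq => ?_
  have hx0 : 0 < x := by
    refine lt_of_le_of_ne hx.1 fun h0 => ?_
    rw [← h0, h.left] at heq
    linarith [hψ.neg_left]
  have hxh : x < 1 / 2 := hx.2.trans_le hX
  have hmin : IsLocalMin (fun y => u y - (a * y + b)) x := by
    filter_upwards [Ioo_mem_nhds hx0 hxh] with y hy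
    have h1 := h.le y ⟨hy.1.le, by linarith [hy.2]⟩
    rw [hab y ⟨hy.1.le, hy.2.le⟩] at h1
    rw [← heq, hab x ⟨hx0.le, hxh.le⟩]
    linarith
  have hd : HasDerivAt (fun y => u y - (a * y + b)) (v x - a * 1) x :=
    (h.hasDerivAt x).sub (((hasDerivAt_id x).const_mul a).add_const b)
  have hva := hmin.hasDerivAt_eq_zero hd
  -- At a contact point the slope of `u` equals `a`. By concavity `u y - a y` increases on `[0, x]`,
  -- so `0 ≤ u x - a x = b`, contradicting `b < 0`.
  have hP := h.prim_u.add (IsPrim.of_contDiff (S := fun y => -a * y) (by fun_prop))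
  have hS : ∀ y, deriv (fun y => -a * y) y = -a := fun y => by simp
  have := hP.le_of_ae_nonneg hx0.le (ae_of_all _ fun t ht => by
    rw [hS]
    have := hv ⟨ht.1.le, by linarith [ht.2]⟩ ⟨hx0.le, by linarith⟩ ht.2.le
    linarith)
  rw [h.left, ← heq, hab x ⟨hx0.le, hxh.le⟩] at this
  linarith

lemma IsProfile.nonneg {p : ℝ} {ψ u v z : ℝ → ℝ} (h : IsProfile p ψ u v z)
    (hv : AntitoneOn v (Icc 0 1)) : ∀ x ∈ Icc (0 : ℝ) 1, 0 ≤ u x := by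
  intro x hx
  rcases le_total 0 (v x) with h0 | h0
  · have := h.prim_u.le_of_ae_nonneg hx.1 (ae_of_all _ fun t ht =>
      h0.trans (hv ⟨ht.1.le, ht.2.le.trans hx.2⟩ hx ht.2.le))
    rwa [h.left] at this
  · have := h.prim_u.neg.le_of_ae_nonneg hx.2 (ae_of_all _ fun t ht =>
      neg_nonneg.2 ((hv hx ⟨hx.1.trans ht.1.le, ht.2.le⟩ ht.1.le).trans h0))
    rw [h.right] at this
    linarith

lemma IsPrim.reflect {f g : ℝ → ℝ} (h : IsPrim f g) :
    IsPrim (fun x => f (1 - x)) (fun x => -g (1 - x)) := by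
  refine ⟨fun a b => ?_, fun x => ?_⟩
  · have := (h.1 (1 - a) (1 - b)).comp_sub_left 1
    simp only [sub_sub_cancel] at this
    exact this.neg
  · rw [intervalIntegral.integral_neg, intervalIntegral.integral_comp_sub_left, h.integral_eq]
    ring

lemma measurePreserving_reflect : MeasurePreserving (fun x : ℝ => 1 - x) unitVol unitVol := by
  have := (Measure.measurePreserving_sub_left (volume : Measure ℝ) 1).restrict_preimage
    (s := Ioo (0 : ℝ) 1) measurableSet_Ioo
  simpa using this

/-- `G'` is even because `G` is odd, so the reflection `x ↦ 1 - x` preserves the energy. This moves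
a maximum point from the right half to the left. -/
lemma IsProfileMinimizer.reflect {p : ℝ} {G ψ u v z : ℝ → ℝ}
    (hodd : ∀ s, G (-s) = -G s) (hψ : ∀ x ∈ Icc (0 : ℝ) 1, ψ x = ψ (1 - x))
    (h : IsProfileMinimizer p G ψ u v z) :
    IsProfileMinimizer p G ψ (fun x => u (1 - x)) (fun x => -v (1 - x)) (fun x => z (1 - x)) := by
  refine ⟨⟨h.1.prim_u.reflect, by simpa using h.1.prim_v.reflect.neg,
    h.1.memLp.comp_measurePreserving measurePreserving_reflect, by simpa using h.1.right,
    by simpa using h.1.left, fun x hx => ?_⟩, fun u' v' z' h' => ?_⟩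
  · rw [hψ x hx]
    exact h.1.le (1 - x) ⟨by linarith [hx.2], by linarith [hx.1]⟩
  · refine le_of_eq_of_le ?_ (h.2 u' v' z' h')
    have heven : ∀ s, deriv G (-s) = deriv G s := fun s => by
      have h1 : (fun s => G (-s)) = fun s => -G s := funext hodd
      have h2 := congrFun (congrArg deriv h1) s
      rw [deriv_comp_neg, deriv.fun_neg] at h2
      linarith
    simp only [profileEnergy, heven]
    rw [setIntegral_unit, setIntegral_unit,
      intervalIntegral.integral_comp_sub_left (fun x => |deriv G (v x) * z x| ^ p)]
    simp

/-- The factor `1 / 2` in the bound is the position `X ≤ 1 / 2` of the maximum in `u X = X * H(A)`.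
-/
lemma IsProfileMinimizer.le_supBound_of_le_half {p : ℝ} (hp : 1 < p) {G ψ u v z : ℝ → ℝ}
    (hG : IsAdmissibleG G) (hψ : IsSymmCone ψ) (h : IsProfileMinimizer p G ψ u v z) {X : ℝ}
    (hX : X ∈ Ioo (0 : ℝ) 1) (hmax : IsMaxOn u (Icc 0 1) X) (hX2 : X ≤ 1 / 2) (huX : 0 < u X) :
    ENNReal.ofReal (u X) ≤ supBound p G := by
  have hanti := h.antitoneOn hp hG.smooth hG.deriv_pos
  obtain ⟨c, hEL⟩ := h.euler_lagrange hp hG.smooth hG.deriv_pos hψ.cont hX.1 hX.2.le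
    (lt_profile_of_antitoneOn hψ h.1 hanti hX2)
  have hvX : v X = 0 :=
    (hmax.isLocalMax (Icc_mem_nhds hX.1 hX.2)).hasDerivAt_eq_zero (h.1.hasDerivAt X)
  obtain ⟨hA, heq⟩ := height_eq_mul_ratioH hp hG.smooth hG.deriv_pos h.1.prim_u h.1.prim_v
    h.1.left hX.1 hvX huX hEL
  have hH : 0 < ratioH p G (v 0) := by
    rw [heq] at huX
    exact pos_of_mul_pos_right huX hX.1.le
  have h1 : u X ≤ 1 / 2 * ratioH p G (v 0) := by
    rw [heq]
    exact mul_le_mul_of_nonneg_right hX2 hH.le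
  calc ENNReal.ofReal (u X) ≤ ENNReal.ofReal (1 / 2 * ratioH p G (v 0)) :=
        ENNReal.ofReal_le_ofReal h1
    _ = 1 / 2 * ENNReal.ofReal (ratioH p G (v 0)) := by
        rw [ENNReal.ofReal_mul (by norm_num), ENNReal.ofReal_div_of_pos two_pos]
        simp
    _ ≤ supBound p G := by
        unfold supBound
        gcongr
        exact le_iSup (fun A : Ioi (0 : ℝ) => ENNReal.ofReal (ratioH p G A)) ⟨v 0, hA⟩

lemma IsProfileMinimizer.ofReal_le_supBound {p : ℝ} (hp : 1 < p) {G ψ u v z : ℝ → ℝ}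
    (hG : IsAdmissibleG G) (hψ : IsSymmCone ψ) (h : IsProfileMinimizer p G ψ u v z) :
    ∀ x ∈ Icc (0 : ℝ) 1, ENNReal.ofReal (u x) ≤ supBound p G := by
  obtain ⟨X, hX, hmax⟩ := isCompact_Icc.exists_isMaxOn (nonempty_Icc.2 zero_le_one)
    (h.1.prim_u.continuous.continuousOn (s := Icc (0 : ℝ) 1))
  obtain ⟨x₀, hx₀, hψ₀⟩ := hψ.pos
  have hx₀' := Ioo_subset_Icc_self hx₀
  have huX : 0 < u X := hψ₀.trans_le ((h.1.le x₀ hx₀').trans (hmax hx₀'))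
  have hXo : X ∈ Ioo (0 : ℝ) 1 := by
    refine ⟨lt_of_le_of_ne hX.1 ?_, lt_of_le_of_ne hX.2 ?_⟩
    · rintro rfl
      exact huX.ne' h.1.left
    · rintro rfl
      exact huX.ne' h.1.right
  intro x hx
  refine (ENNReal.ofReal_le_ofReal (hmax hx)).trans ?_
  rcases le_total X (1 / 2) with hX2 | hX2
  · exact h.le_supBound_of_le_half hp hG hψ hXo hmax hX2 huX
  · have hr := h.reflect hG.odd hψ.symm
    have hmax' : IsMaxOn (fun x => u (1 - x)) (Icc 0 1) (1 - X) := fun y hy => by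
      have := hmax (a := 1 - y) ⟨by linarith [hy.2], by linarith [hy.1]⟩
      simpa using this
    have := hr.le_supBound_of_le_half hp hG hψ (X := 1 - X)
      ⟨by linarith [hXo.2], by linarith [hXo.1]⟩ hmax' (by linarith) (by simpa using huX)
    simpa using this

/-- Both bounds come from `0 ≤ ψ⁺ ≤ u` on `[0,1]`; the second one excludes minimizers over tall
obstacles. -/
lemma IsMinimizer.supNorm_le {p : ℝ} (hp : 1 < p) {G ψ u : ℝ → ℝ} (hG : IsAdmissibleG G)
    (hψ : IsSymmCone ψ) (hu : IsMinimizer p G ψ u) :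
    supNorm u ≤ supBound p G ∧ supNorm (fun x => max (ψ x) 0) ≤ supBound p G := by
  obtain ⟨u', v, z, h, heq⟩ := hu.exists_profile hp hG.smooth
  have hb := h.ofReal_le_supBound hp hG hψ
  have hnn := h.1.nonneg (h.antitoneOn hp hG.smooth hG.deriv_pos)
  have key : ∀ f : ℝ → ℝ, (∀ x ∈ Icc (0 : ℝ) 1, 0 ≤ f x ∧ f x ≤ u' x) →
      supNorm f ≤ supBound p G := by
    intro f hf
    rw [supNorm, eLpNorm_exponent_top]
    refine eLpNormEssSup_le_of_ae_enorm_bound (ae_unit_iff.2 (ae_of_all _ fun x hx => ?_))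
    have hx' := Ioo_subset_Icc_self hx
    rw [Real.enorm_eq_ofReal (hf x hx').1]
    exact (ENNReal.ofReal_le_ofReal (hf x hx').2).trans (hb x hx')
  refine ⟨key u fun x hx => ?_, key _ fun x hx => ⟨le_max_right _ _,
    max_le (h.1.le x hx) (hnn x hx)⟩⟩
  rw [heq hx]
  exact ⟨hnn x hx, le_rfl⟩

end PElastica

theorem lemma5p1 (p : ℝ) (hp : 1 < p) (G : ℝ → ℝ) (hG : PElastica.IsAdmissibleG G)
    (ψ : ℝ → ℝ) (hψ : PElastica.IsSymmCone ψ) :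
    (∀ u : ℝ → ℝ, PElastica.IsMinimizer p G ψ u →
      PElastica.supNorm u ≤ PElastica.supBound p G) ∧
    (PElastica.supBound p G < PElastica.supNorm (fun x => max (ψ x) 0) →
      ¬ ∃ u : ℝ → ℝ, PElastica.IsMinimizer p G ψ u) := by
  refine ⟨fun u hu => (hu.supNorm_le hp hG hψ).1, ?_⟩
  rintro hlt ⟨u, hu⟩
  exact absurd (hu.supNorm_le hp hG hψ).2 (not_le.2 hlt)
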